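/- **Setting.** Work on Minkowski space $\mathbb R\times\mathbb R^3$ with coordinates $x^0=t$, $\mathbf x=(x^1,x^2,x^3)$ and metric $g=\mathrm{diag}(-1,1,1,1)$; Greek indices run from $0$ to $3$, repeated indices are summed, $\partial_\nu=\partial/\partial x^\nu$. A perfect fluid is described by its number density $n\ge 0$, entropy per particle $s\ge 0$ and the spatial part $\mathbf u$ of its four-velocity $u=(u^0,\mathbf u)$, $u^0=\sqrt{1+|\mathbf u|^2}$. Its equation of state $\rho=\rho(n,s)\ge0$ (proper energy density) is of class $C^2$ on $\{n>0,\ s\ge 0\}$; the pressure is $p=n\,\partial\rho/\partial n-\rho$ (read as $p=-\rho$ at $n=0$), and it is assumed that $0\le p\le\rho$ for $n,s\ge0$ and that for $n>0$, $s\ge0$ $$\frac{\partial\rho}{\partial n}>0,\qquad \frac{\partial p}{\partial n}>0,\qquad \frac{\partial\rho}{\partial s}\ge 0\ \text{ with equality iff } s=0 .$$ The sound speed $\eta\ge0$ is given by $\eta^2=(dp/d\rho)_s=\frac{\partial p/\partial n}{\partial\rho/\partial n}$. Since $p$ is strictly increasing in $n$, for $n>0$ one may use $(p,s)$ as thermodynamic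 variables. The energy tensor is $T^{\mu\nu}=(\rho+p)u^\mu u^\nu+p\,g^{\mu\nu}$, and the equations of motion are $$\partial_\nu(nu^\nu)=0,\qquad (\rho+p)u^\nu\partial_\nu u^\mu+(g^{\mu\nu}+u^\mu u^\nu)\partial_\nu p=0,\qquad u^\nu\partial_\nu s=0. \tag{1}$$ A global-in-time $C^1$ solution is a triple $(n,s,\mathbf u)$ of class $C^1$ on $[0,\infty)\times\mathbb R^3$, with $n,s\ge0$, that satisfies (1) for $t>0$; at vacuum points $n=0$, if there are any, this includes that $\rho(n,s)$ and $p(n,s)$ are $C^1$ functions of $(t,\mathbf x)$ (where $n>0$ this is automatic). The initial data $(n_0,s_0,\mathbf u_0)$ at $t=0$ are smooth, $n_0,s_0\ge0$, and for some constants $R_0,\bar n,\bar s>0$ one has $n_0=\bar n$, $s_0=\bar s$, $\mathbf u_0=0$ for $|\mathbf x|>R_0$. Put $\bar\rho=\rho(\bar n,\bar s)$, $\bar\eta=\eta(\bar n,\bar s)$, and, evaluated on the data, $$E=\int_{\mathbb R^3}(T^{00}-\bar\rho)\,d\mathbf x,\qquad Q(0)=\int_{\mathbb R^3}\sum_{i=1}^3x^iT^{0i}\,d\mathbf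 x=\int_{\mathbb R^3}(\rho+p)\,u^0\,\mathbf x\cdot\mathbf u\,d\mathbf x .$$ **Theorem.** Assume that the equation of state satisfies * (A1) $\rho(p,s)$ is a non-increasing function of $s$ for each $p$; * (A2) $\eta(p,s)$ is a non-decreasing function of $p$ for each $s$; and that the initial data satisfy * (D1) $\bar\eta<\frac13$; * (D2) $E>0$; * (D3) $s_0(\mathbf x)\ge\bar s$ for all $|\mathbf x|\le R_0$; * (D4) $\displaystyle Q(0)>\frac{2\bar\eta}{1-3\bar\eta^2}\left(\int_{R_0}^\infty\frac{dr}{E\,r^2+\frac{4\pi}{3}\bar\rho\,r^5}\right)^{-1}.$ Then the Cauchy problem for (1) with these initial data has no global-in-time $C^1$ solution. -/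

import Mathlib

open scoped ContDiff

namespace RelFluid

noncomputable section

/-- Physical space `ℝ³` with the Euclidean norm. -/
abbrev Space : Type := EuclideanSpace ℝ (Fin 3)

/-- Minkowski spacetime in the global coordinates `(t, x)`. -/
abbrev Spacetime : Type := ℝ × Space

/-- The components `diag(-1, 1, 1, 1)` of the Minkowski metric; the inverse metric has the same
components. -/
def minkowski (μ ν : Fin 4) : ℝ :=
  if μ = ν then (if μ = 0 then -1 else 1) else 0

/-- The coordinate vector `∂_μ` of spacetime; index `0` is time, `1, 2, 3` are space. -/
def coordVec (μ : Fin 4) : Spacetime :=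
  (Fin.cons ((1 : ℝ), (0 : Space)) fun i : Fin 3 => ((0 : ℝ), EuclideanSpace.single i (1 : ℝ)) :
    Fin 4 → Spacetime) μ

/-- The partial derivative `∂_μ f` at the event `z`. -/
def partialD (μ : Fin 4) (f : Spacetime → ℝ) (z : Spacetime) : ℝ :=
  fderiv ℝ f z (coordVec μ)

/-- The four-velocity `(√(1 + |v|²), v)` with spatial part `v`. -/
def fourVel (v : Space) (μ : Fin 4) : ℝ :=
  (Fin.cons (Real.sqrt (1 + ‖v‖ ^ 2)) fun i : Fin 3 => v i : Fin 4 → ℝ) μ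

/-! ### Thermodynamics: `ρ n s` is the proper energy density as a function of the number density
`n` and the entropy per particle `s`. -/

/-- The pressure `p = n ∂ρ/∂n - ρ`. -/
def pressure (ρ : ℝ → ℝ → ℝ) (n s : ℝ) : ℝ :=
  n * deriv (fun m => ρ m s) n - ρ n s

/-- The sound speed: `η² = (dp/dρ)_s = (∂p/∂n) / (∂ρ/∂n)`. -/
def soundSpeed (ρ : ℝ → ℝ → ℝ) (n s : ℝ) : ℝ :=
  Real.sqrt (deriv (fun m => pressure ρ m s) n / deriv (fun m => ρ m s) n)

/-- The basic assumptions on the equation of state of a perfect fluid. The variables range over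
`n ≥ 0`, `s ≥ 0`; the conditions on derivatives concern `n > 0`. -/
structure IsEquationOfState (ρ : ℝ → ℝ → ℝ) : Prop where
  contDiffOn : ContDiffOn ℝ 2 (fun q : ℝ × ℝ => ρ q.1 q.2) (Set.Ioi 0 ×ˢ Set.Ici 0)
  rho_nonneg : ∀ n s, 0 ≤ n → 0 ≤ s → 0 ≤ ρ n s
  pressure_nonneg : ∀ n s, 0 ≤ n → 0 ≤ s → 0 ≤ pressure ρ n s
  pressure_le_rho : ∀ n s, 0 ≤ n → 0 ≤ s → pressure ρ n s ≤ ρ n s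
  deriv_rho_pos : ∀ n s, 0 < n → 0 ≤ s → 0 < deriv (fun m => ρ m s) n
  deriv_pressure_pos : ∀ n s, 0 < n → 0 ≤ s → 0 < deriv (fun m => pressure ρ m s) n
  deriv_entropy_nonneg : ∀ n s, 0 < n → 0 ≤ s → 0 ≤ derivWithin (fun σ => ρ n σ) (Set.Ici 0) s
  deriv_entropy_eq_zero_iff : ∀ n s, 0 < n → 0 ≤ s →
    (derivWithin (fun σ => ρ n σ) (Set.Ici 0) s = 0 ↔ s = 0)

/-- `ρ`, regarded as a function `ρ(p, s)` of pressure and entropy, is non-increasing in `s` for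
each `p`: two states with the same pressure are compared. (At fixed `s` the pressure is strictly
increasing in `n`, so `(p, s)` determines `n`.) -/
def RhoAntitoneInEntropy (ρ : ℝ → ℝ → ℝ) : Prop :=
  ∀ n₁ s₁ n₂ s₂ : ℝ, 0 < n₁ → 0 ≤ s₁ → 0 < n₂ → 0 ≤ s₂ →
    pressure ρ n₁ s₁ = pressure ρ n₂ s₂ → s₁ ≤ s₂ → ρ n₂ s₂ ≤ ρ n₁ s₁

/-- `η`, regarded as a function `η(p, s)` of pressure and entropy, is non-decreasing in `p` for
each `s`. -/
def SoundSpeedMonotoneInPressure (ρ : ℝ → ℝ → ℝ) : Prop :=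
  ∀ n₁ n₂ s : ℝ, 0 < n₁ → 0 < n₂ → 0 ≤ s →
    pressure ρ n₁ s ≤ pressure ρ n₂ s → soundSpeed ρ n₁ s ≤ soundSpeed ρ n₂ s

/-- The energy tensor `T^{μν} = (ρ + p) u^μ u^ν + p g^{μν}` of the state `(n, s, v)`. -/
def energyTensor (ρ : ℝ → ℝ → ℝ) (n s : ℝ) (v : Space) (μ ν : Fin 4) : ℝ :=
  (ρ n s + pressure ρ n s) * fourVel v μ * fourVel v ν + pressure ρ n s * minkowski μ ν

/-- `(n, s, u)` is a `C¹` solution on `[0, ∞) × ℝ³` of the relativistic perfect-fluid equations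
with data `(n₀, s₀, u₀)` at `t = 0`. The conditions `contDiff_rho` and `contDiff_pressure` follow
from the `C¹` regularity of `n` and `s` wherever `n > 0`; they matter only at vacuum points. -/
structure IsGlobalC1Solution (ρ : ℝ → ℝ → ℝ) (n₀ s₀ : Space → ℝ) (u₀ : Space → Space)
    (n s : Spacetime → ℝ) (u : Spacetime → Space) : Prop where
  contDiff_n : ContDiffOn ℝ 1 n (Set.Ici 0 ×ˢ Set.univ)
  contDiff_s : ContDiffOn ℝ 1 s (Set.Ici 0 ×ˢ Set.univ)
  contDiff_u : ContDiffOn ℝ 1 u (Set.Ici 0 ×ˢ Set.univ)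
  contDiff_rho : ContDiffOn ℝ 1 (fun z => ρ (n z) (s z)) (Set.Ici 0 ×ˢ Set.univ)
  contDiff_pressure : ContDiffOn ℝ 1 (fun z => pressure ρ (n z) (s z)) (Set.Ici 0 ×ˢ Set.univ)
  n_nonneg : ∀ z : Spacetime, 0 ≤ z.1 → 0 ≤ n z
  s_nonneg : ∀ z : Spacetime, 0 ≤ z.1 → 0 ≤ s z
  /-- `∂_ν (n u^ν) = 0`. -/
  continuity : ∀ z : Spacetime, 0 < z.1 →
    ∑ ν, partialD ν (fun y => n y * fourVel (u y) ν) z = 0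
  /-- `(ρ + p) u^ν ∂_ν u^μ + (g^{μν} + u^μ u^ν) ∂_ν p = 0`. -/
  momentum : ∀ z : Spacetime, 0 < z.1 → ∀ μ,
    (ρ (n z) (s z) + pressure ρ (n z) (s z)) *
        ∑ ν, fourVel (u z) ν * partialD ν (fun y => fourVel (u y) μ) z +
      ∑ ν, (minkowski μ ν + fourVel (u z) μ * fourVel (u z) ν) *
        partialD ν (fun y => pressure ρ (n y) (s y)) z = 0
  /-- `u^ν ∂_ν s = 0`. -/
  adiabatic : ∀ z : Spacetime, 0 < z.1 → ∑ ν, fourVel (u z) ν * partialD ν s z = 0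
  init_n : ∀ x, n (0, x) = n₀ x
  init_s : ∀ x, s (0, x) = s₀ x
  init_u : ∀ x, u (0, x) = u₀ x

/-- The data are smooth and coincide outside the ball of radius `R₀` with the quiet state of
number density `nbar` and entropy `sbar`. -/
structure IsQuietPerturbation (R₀ nbar sbar : ℝ) (n₀ s₀ : Space → ℝ) (u₀ : Space → Space) :
    Prop where
  R₀_pos : 0 < R₀
  nbar_pos : 0 < nbar
  sbar_pos : 0 < sbar
  contDiff_n₀ : ContDiff ℝ ∞ n₀
  contDiff_s₀ : ContDiff ℝ ∞ s₀
  contDiff_u₀ : ContDiff ℝ ∞ u₀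
  n₀_nonneg : ∀ x, 0 ≤ n₀ x
  s₀_nonneg : ∀ x, 0 ≤ s₀ x
  n₀_eq : ∀ x, R₀ < ‖x‖ → n₀ x = nbar
  s₀_eq : ∀ x, R₀ < ‖x‖ → s₀ x = sbar
  u₀_eq : ∀ x, R₀ < ‖x‖ → u₀ x = 0

/-- The total energy `∫ (T^{00} - T̄^{00}) dx` of the perturbation. -/
def perturbationEnergy (ρ : ℝ → ℝ → ℝ) (nbar sbar : ℝ) (n₀ s₀ : Space → ℝ)
    (u₀ : Space → Space) : ℝ :=
  ∫ x : Space, (energyTensor ρ (n₀ x) (s₀ x) (u₀ x) 0 0 - energyTensor ρ nbar sbar 0 0 0)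

/-- The total radial momentum `∫ ∑ᵢ xⁱ T^{0i} dx`. -/
def radialMomentum (ρ : ℝ → ℝ → ℝ) (n₀ s₀ : Space → ℝ) (u₀ : Space → Space) : ℝ :=
  ∫ x : Space, ∑ i : Fin 3, x i * energyTensor ρ (n₀ x) (s₀ x) (u₀ x) 0 i.succ

end

end RelFluid

/-!
Suppose a global solution exists. Far from the origin the fluid is at rest in the quiet state
`(N, S)`, and it stays so outside the ball of radius `r(t) = R + ηt`, `η` being the sound speed of
the quiet state: the energy current relative to `(N, S, 0)` is divergence-free, vanishes there to
second order, and near the quiet state points into the cones of any slope `c > η`. Hence the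
energy `E` of the perturbation is conserved, and the radial momentum `Q` satisfies the virial
identity `Q' = ∫ ((ρ + p) |u|² + 3 (p - p(N, S))) dx`. By (A1), (A2) and the entropy bound, which
is transported along the flow, `p - p(N, S) ≥ η² (ρ - ρ(N, S))`; since `E > 0` this gives
`Q' ≥ (1 - 3η²) ∫ (ρ + p) |u|² dx`. By Cauchy–Schwarz and `p ≤ ρ`,
`Q² ≤ 2 (E r² + 4π/3 ρ(N, S) r⁵) ∫ (ρ + p) |u|² dx`, so that `Q` obeys a Riccati inequality.
Integrated over all `t > 0`, it bounds `1 / Q(0)` from below and contradicts (D4).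
-/

namespace RelFluid

open MeasureTheory Set Filter Topology

noncomputable section

/-! ### Calculus -/

lemma isMinOn_of_sub_mul_hasDerivAt_nonneg {D : Set ℝ} (hD : D.OrdConnected) {f f' : ℝ → ℝ} {a : ℝ}
    (ha : a ∈ D) (hf : ∀ x ∈ D, HasDerivAt f (f' x) x) (hf' : ∀ x ∈ D, 0 ≤ (x - a) * f' x) :
    IsMinOn f D a := by
  intro x hx
  rcases le_total a x with hax | hxa
  · have hsub : Icc a x ⊆ D := hD.out ha hx
    refine monotoneOn_of_hasDerivWithinAt_nonneg (convex_Icc a x)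
      (fun y hy => (hf y (hsub hy)).continuousAt.continuousWithinAt)
      (fun y hy => (hf y (hsub (interior_subset hy))).hasDerivWithinAt) (fun y hy => ?_)
      (left_mem_Icc.2 hax) (right_mem_Icc.2 hax) hax
    have hya := sub_pos.2 (interior_Icc (a := a) (b := x) ▸ hy).1
    exact nonneg_of_mul_nonneg_right (hf' y (hsub (interior_subset hy))) hya
  · have hsub : Icc x a ⊆ D := hD.out hx ha
    refine antitoneOn_of_hasDerivWithinAt_nonpos (convex_Icc x a)
      (fun y hy => (hf y (hsub hy)).continuousAt.continuousWithinAt)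
      (fun y hy => (hf y (hsub (interior_subset hy))).hasDerivWithinAt) (fun y hy => ?_)
      (left_mem_Icc.2 hxa) (right_mem_Icc.2 hxa) hxa
    have hya := sub_neg.2 (interior_Icc (a := x) (b := a) ▸ hy).2
    exact nonpos_of_mul_nonneg_right (hf' y (hsub (interior_subset hy))) hya

lemma mul_log_sub_log_le_sub {f f' : ℝ → ℝ} {a x y : ℝ} (hx : 0 < x) (hxy : x ≤ y)
    (hf : ∀ m ∈ Icc x y, HasDerivAt f (f' m) m) (hf' : ∀ m ∈ Icc x y, a ≤ m * f' m) :
    a * (Real.log y - Real.log x) ≤ f y - f x := by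
  have hd : ∀ m ∈ Icc x y, HasDerivAt (fun m => f m - a * Real.log m) (f' m - a * m⁻¹) m :=
    fun m hm => (hf m hm).sub ((Real.hasDerivAt_log (hx.trans_le hm.1).ne').const_mul a)
  have hmono : MonotoneOn (fun m => f m - a * Real.log m) (Icc x y) := by
    refine monotoneOn_of_hasDerivWithinAt_nonneg (convex_Icc x y)
      (fun m hm => (hd m hm).continuousAt.continuousWithinAt)
      (fun m hm => (hd m (interior_subset hm)).hasDerivWithinAt) fun m hm => ?_
    have hm' := interior_subset hm
    rw [sub_nonneg, ← div_eq_mul_inv, div_le_iff₀' (hx.trans_le hm'.1)]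
    exact hf' m hm'
  have h := hmono (left_mem_Icc.2 hxy) (right_mem_Icc.2 hxy) hxy
  simp only at h
  linarith

lemma sq_sub_le_two_mul_bregman {D : Set ℝ} (hD : D.OrdConnected) {f h h' : ℝ → ℝ} {a κ x : ℝ}
    (ha : a ∈ D) (hx : x ∈ D) (hf : ∀ y ∈ D, HasDerivAt f (h y) y)
    (hh : ∀ y ∈ D, HasDerivAt h (h' y) y) (hmono : MonotoneOn h D) (hκ : ∀ y ∈ D, h' y ≤ κ) :
    (h x - h a) ^ 2 ≤ 2 * κ * (f x - f a - h a * (x - a)) := by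
  have hmin := isMinOn_of_sub_mul_hasDerivAt_nonneg hD ha
    (f := fun y => 2 * κ * (f y - f a - h a * (y - a)) - (h y - h a) ^ 2)
    (f' := fun y => 2 * ((h y - h a) * (κ - h' y)))
    (fun y hy => by
      have hb := (((hf y hy).sub_const (f a)).sub
        (((hasDerivAt_id y).sub_const a).const_mul (h a))).const_mul (2 * κ)
      refine (hb.sub (((hh y hy).sub_const (h a)).pow 2)).congr_deriv ?_
      push_cast
      ring)
    fun y hy => by
      have hsign : 0 ≤ (y - a) * (h y - h a) := by
        rcases le_total a y with hay | hya
        · exact mul_nonneg (sub_nonneg.2 hay) (sub_nonneg.2 (hmono ha hy hay))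
        · exact mul_nonneg_of_nonpos_of_nonpos (sub_nonpos.2 hya) (sub_nonpos.2 (hmono hy ha hya))
      nlinarith [mul_nonneg hsign (sub_nonneg.2 (hκ y hy))]
  have h0 := hmin hx
  simp only [mem_ofPred_eq, sub_self, mul_zero] at h0
  linarith

lemma intervalIntegral_le_inv_of_riccati {Q Q' w : ℝ → ℝ} {a b : ℝ} (hab : a ≤ b)
    (hQ : ContinuousOn Q (Icc a b)) (hQ' : ∀ t ∈ Ioo a b, HasDerivAt Q (Q' t) t)
    (hw : ContinuousOn w (Icc a b)) (hw0 : ∀ t ∈ Ioo a b, 0 ≤ w t)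
    (hineq : ∀ t ∈ Ioo a b, w t * Q t ^ 2 ≤ Q' t) (hQa : 0 < Q a) :
    ∫ t in a..b, w t ≤ (Q a)⁻¹ := by
  have hmono : MonotoneOn Q (Icc a b) := by
    refine monotoneOn_of_hasDerivWithinAt_nonneg (f' := Q') (convex_Icc a b) hQ ?_ ?_ <;>
      rw [interior_Icc]
    · exact fun t ht => (hQ' t ht).hasDerivWithinAt
    · exact fun t ht => (mul_nonneg (hw0 t ht) (sq_nonneg _)).trans (hineq t ht)
  have hpos : ∀ t ∈ Icc a b, 0 < Q t := fun t ht =>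
    hQa.trans_le (hmono (left_mem_Icc.2 hab) ht ht.1)
  have h := intervalIntegral.integral_le_sub_of_hasDeriv_right_of_le (g := fun t => -(Q t)⁻¹)
    (g' := fun t => Q' t / Q t ^ 2) hab (hQ.inv₀ fun t ht => (hpos t ht).ne').neg
    (fun t ht => ((hQ' t ht).inv (hpos t (Ioo_subset_Icc_self ht)).ne').neg.hasDerivWithinAt
      |>.congr_deriv (by rw [neg_div, neg_neg]))
    hw.integrableOn_Icc
    fun t ht => (le_div_iff₀ (pow_pos (hpos t (Ioo_subset_Icc_self ht)) 2)).2 (hineq t ht)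
  have hb := inv_pos.2 (hpos b (right_mem_Icc.2 hab))
  linarith

lemma integral_Ioi_le_of_riccati {Q Q' g : ℝ → ℝ} {R η : ℝ} (hη : 0 < η)
    (hQ : ContinuousOn Q (Ici 0)) (hQ' : ∀ t, 0 < t → HasDerivAt Q (Q' t) t)
    (hg : ContinuousOn g (Ici R)) (hg0 : ∀ r ∈ Ioi R, 0 ≤ g r) (hgi : IntegrableOn g (Ioi R))
    (hineq : ∀ t, 0 < t → g (R + η * t) * Q t ^ 2 ≤ Q' t) (hQ0 : 0 < Q 0) :
    ∫ r in Ioi R, g r ≤ η * (Q 0)⁻¹ := by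
  refine le_of_tendsto (intervalIntegral_tendsto_integral_Ioi R hgi
    (tendsto_atTop_add_const_left _ R (tendsto_id.const_mul_atTop hη))) ?_
  filter_upwards [eventually_ge_atTop 0] with T hT
  have h := intervalIntegral_le_inv_of_riccati (w := fun t => g (R + η * t)) hT
    (hQ.mono Icc_subset_Ici_self) (fun t ht => hQ' t ht.1)
    (hg.comp (by fun_prop) fun t ht => le_add_of_nonneg_right (mul_nonneg hη.le ht.1))
    (fun t ht => hg0 _ (lt_add_of_pos_right R (mul_pos hη ht.1)))
    (fun t ht => hineq t ht.1) hQ0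
  rw [intervalIntegral.integral_comp_add_mul _ hη.ne', mul_zero, add_zero, smul_eq_mul,
    inv_mul_le_iff₀ hη] at h
  exact h

lemma sq_integral_le_mul_integral {α : Type*} [MeasurableSpace α] {μ : Measure α} {q m k : α → ℝ}
    (hq : Integrable q μ) (hm : Integrable m μ) (hk : Integrable k μ) (hm0 : ∀ x, 0 ≤ m x)
    (hk0 : ∀ x, 0 ≤ k x) (hqmk : ∀ x, q x ^ 2 ≤ m x * k x) :
    (∫ x, q x ∂μ) ^ 2 ≤ (∫ x, m x ∂μ) * ∫ x, k x ∂μ := by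
  have hquad : ∀ a : ℝ, 0 ≤ (∫ x, m x ∂μ) * (a * a) + (2 * ∫ x, q x ∂μ) * a + ∫ x, k x ∂μ := by
    intro a
    have hpt : ∀ x, 0 ≤ m x * (a * a) + 2 * q x * a + k x := fun x => by
      rcases (hm0 x).eq_or_lt with h0 | h0
      · have hq0 : q x = 0 := by
          have := hqmk x
          rw [← h0, zero_mul] at this
          exact pow_eq_zero_iff two_ne_zero |>.1 (le_antisymm this (sq_nonneg _))
        simpa [← h0, hq0] using hk0 x
      · refine nonneg_of_mul_nonneg_right (a := m x) ?_ h0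
        nlinarith [hqmk x, sq_nonneg (m x * a + q x)]
    have h : 0 ≤ ∫ x, (m x * (a * a) + 2 * q x * a + k x) ∂μ := integral_nonneg hpt
    have hmq : Integrable (fun x => m x * (a * a) + 2 * q x * a) μ :=
      (hm.mul_const _).add ((hq.const_mul 2).mul_const a)
    rwa [integral_add hmq hk,
      integral_add (hm.mul_const _) ((hq.const_mul 2).mul_const a), integral_mul_const,
      integral_mul_const, integral_const_mul] at h
  have h := discrim_le_zero hquad
  rw [discrim] at h
  linarith

lemma integral_fderiv_eq_zero {E : Type*} [NormedAddCommGroup E] [NormedSpace ℝ E]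
    [FiniteDimensional ℝ E] [MeasurableSpace E] [BorelSpace E] {μ : Measure E}
    [μ.IsAddHaarMeasure] {f : E → ℝ} (hf : Differentiable ℝ f) (v : E)
    (hc : Continuous fun x => fderiv ℝ f x v) (hs : HasCompactSupport f) :
    ∫ x, fderiv ℝ f x v ∂μ = 0 := by
  have h := integral_mul_fderiv_eq_neg_fderiv_mul_of_integrable (μ := μ)
    (f := fun _ : E => (1 : ℝ)) (g := f) (v := v) (by simp)
    (by simpa using hc.integrable_of_hasCompactSupport (hs.fderiv_apply ℝ v))
    (by simpa using hf.continuous.integrable_of_hasCompactSupport hs)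
    (fun x _ => differentiableAt_const 1) (fun x _ => hf x)
  simpa using h

lemma integrableOn_Ioi_one_div {E a R : ℝ} (hE : 0 < E) (ha : 0 ≤ a) (hR : 0 < R) :
    IntegrableOn (fun r : ℝ => 1 / (E * r ^ 2 + a * r ^ 5)) (Ioi R) := by
  refine ((integrableOn_Ioi_rpow_of_lt (a := -2) (by norm_num) hR).const_mul E⁻¹).mono'
    (by fun_prop : Measurable _).aestronglyMeasurable ?_
  filter_upwards [ae_restrict_mem measurableSet_Ioi] with r hr
  have hr0 : 0 < r := hR.trans hr
  rw [Real.norm_of_nonneg (by positivity), Real.rpow_neg hr0.le, Real.rpow_two, ← mul_inv, one_div]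
  exact inv_anti₀ (by positivity) (le_add_of_nonneg_right (by positivity))

lemma integral_Ioi_one_div_pos {E a R : ℝ} (hE : 0 < E) (ha : 0 ≤ a) (hR : 0 < R) :
    0 < ∫ r in Ioi R, 1 / (E * r ^ 2 + a * r ^ 5) := by
  have hpos : ∀ r ∈ Ioi R, 0 < 1 / (E * r ^ 2 + a * r ^ 5) := fun r hr => by
    have hr0 : 0 < r := hR.trans hr
    positivity
  have hsupp : Ioi R ⊆ Function.support fun r => 1 / (E * r ^ 2 + a * r ^ 5) :=
    fun r hr => (hpos r hr).ne'
  rw [setIntegral_pos_iff_support_of_nonneg_ae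
    ((ae_restrict_mem measurableSet_Ioi).mono fun r hr => (hpos r hr).le)
    (integrableOn_Ioi_one_div hE ha hR), inter_eq_right.2 hsupp, Real.volume_Ioi]
  exact ENNReal.zero_lt_top

/-! ### Transport along backward cones -/

section Transport

variable {E : Type*} [NormedAddCommGroup E] {c τ t m : ℝ} {x : E} {f : ℝ × E → ℝ}

/-- The closed backward cone of slope `c` with tip `(t, x)`, truncated below at time `τ`. For
`c = 0` it is a vertical segment. -/
def backwardCone (c τ t : ℝ) (x : E) : Set (ℝ × E) :=
  {z | τ ≤ z.1 ∧ z.1 ≤ t ∧ ‖z.2 - x‖ ≤ c * (t - z.1)}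

lemma tip_mem_backwardCone (hτt : τ ≤ t) : (t, x) ∈ backwardCone c τ t x :=
  ⟨hτt, le_rfl, by simp⟩

lemma isCompact_backwardCone [ProperSpace E] : IsCompact (backwardCone c τ t x) := by
  have hslope : IsClosed {z : ℝ × E | ‖z.2 - x‖ ≤ c * (t - z.1)} :=
    isClosed_le (by fun_prop) (by fun_prop)
  have hclosed : IsClosed (backwardCone c τ t x) :=
    (isClosed_le continuous_const continuous_fst).inter
      ((isClosed_le continuous_fst continuous_const).inter hslope)
  refine (isCompact_Icc.prod (isCompact_closedBall x (|c| * (t - τ)))).of_isClosed_subset hclosed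
    fun z hz => ⟨⟨hz.1, hz.2.1⟩, mem_closedBall_iff_norm.2 (hz.2.2.trans ?_)⟩
  have ht := sub_nonneg.2 hz.2.1
  exact mul_le_mul (le_abs_self c) (by linarith [hz.1]) ht (abs_nonneg c)

variable [NormedSpace ℝ E]

lemma neg_mem_posTangentConeAt_backwardCone {z X : ℝ × E} (hz : z ∈ backwardCone c τ t x)
    (hτz : τ < z.1) (hX : 0 < X.1) (hXc : ‖X.2‖ ≤ c * X.1) :
    -X ∈ posTangentConeAt (backwardCone c τ t x) z := by
  refine mem_posTangentConeAt_of_frequently_mem (Eventually.frequently ?_)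
  have hsmall : ∀ᶠ h in 𝓝[>] (0 : ℝ), h * X.1 < z.1 - τ :=
    ((continuous_mul_const X.1).tendsto' 0 0 (zero_mul _)).eventually_lt_const (sub_pos.2 hτz)
      |>.filter_mono nhdsWithin_le_nhds
  filter_upwards [hsmall, self_mem_nhdsWithin] with h hh h0
  have h0 : 0 < h := h0
  refine ⟨?_, ?_, ?_⟩ <;> simp only [Prod.fst_add, Prod.snd_add, Prod.smul_fst, Prod.smul_snd,
    Prod.fst_neg, Prod.snd_neg, smul_eq_mul, smul_neg]
  · linarith
  · linarith [hz.2.1, mul_pos h0 hX]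
  · calc ‖z.2 + -(h • X.2) - x‖ = ‖(z.2 - x) - h • X.2‖ := by congr 1; abel
      _ ≤ ‖z.2 - x‖ + h * ‖X.2‖ := by
        simpa [norm_smul, abs_of_pos h0] using norm_sub_le (z.2 - x) (h • X.2)
      _ ≤ c * (t - z.1) + h * (c * X.1) := by gcongr; exact hz.2.2
      _ = c * (t - (z.1 + -(h * X.1))) := by ring

lemma le_tip_of_fderiv_nonneg [ProperSpace E] (X : ℝ × E → ℝ × E) (hτt : τ ≤ t)
    (hf : ContinuousOn f (backwardCone c τ t x))
    (hd : ∀ z ∈ backwardCone c τ t x, τ < z.1 → DifferentiableAt ℝ f z)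
    (hX : ∀ z ∈ backwardCone c τ t x, 0 < (X z).1)
    (hXc : ∀ z ∈ backwardCone c τ t x, ‖(X z).2‖ ≤ c * (X z).1)
    (hfX : ∀ z ∈ backwardCone c τ t x, τ < z.1 → 0 ≤ fderiv ℝ f z (X z))
    (hm : ∀ y, ‖y - x‖ ≤ c * (t - τ) → m ≤ f (τ, y)) : m ≤ f (t, x) := by
  have htip : (t, x) ∈ backwardCone c τ t x := tip_mem_backwardCone hτt
  -- The perturbation `ε (z.1 - τ)` pushes the minimum over the cone down to its base.
  have hε : ∀ ε > 0, m ≤ f (t, x) + ε * (t - τ) := fun ε hε => by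
    obtain ⟨z, hzK, hz⟩ := isCompact_backwardCone.exists_isMinOn ⟨_, htip⟩
      (hf.add (g := fun z => ε * (z.1 - τ)) (by fun_prop))
    have hzτ : z.1 = τ := by
      by_contra hne
      have hτz : τ < z.1 := lt_of_le_of_ne hzK.1 (Ne.symm hne)
      have hg := (hd z hzK hτz).hasFDerivAt.add
        (((hasFDerivAt_fst (𝕜 := ℝ) (p := z)).sub_const τ).const_mul ε)
      have h := hz.localize.hasFDerivWithinAt_nonneg hg.hasFDerivWithinAt
        (neg_mem_posTangentConeAt_backwardCone hzK hτz (hX z hzK) (hXc z hzK))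
      simp only [map_neg, add_apply, smul_apply,
        ContinuousLinearMap.coe_fst', smul_eq_mul] at h
      linarith [hfX z hzK hτz, mul_pos hε (hX z hzK)]
    have hbase : m ≤ f z := by
      have h := hm z.2 (hzτ ▸ hzK.2.2)
      rwa [← hzτ] at h
    have h : f z + ε * (z.1 - τ) ≤ f (t, x) + ε * (t - τ) := hz htip
    rw [hzτ, sub_self, mul_zero, add_zero] at h
    exact hbase.trans h
  refine ge_of_tendsto (f := fun ε => f (t, x) + ε * (t - τ)) (x := 𝓝[>] 0) ?_
    (eventually_mem_nhdsWithin.mono hε)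
  have hlim : Continuous fun ε : ℝ => f (t, x) + ε * (t - τ) := by fun_prop
  exact (hlim.tendsto' 0 _ (by ring)).mono_left nhdsWithin_le_nhds

end Transport

/-! ### Divergences on spacetime -/

section Spacetime

variable {f g : Spacetime → ℝ} {F : Fin 4 → Spacetime → ℝ} {z : Spacetime} {t : ℝ} {I : Set ℝ}
  {K : Set Space}

/-- The closed half-space `[0, ∞) × ℝ³` of spacetime, on which solutions are defined. -/
abbrev Future : Set Spacetime := Ici 0 ×ˢ univ

/-- The divergence `∂_ν F^ν` of a vector field on spacetime given by its components. -/
def divergence (F : Fin 4 → Spacetime → ℝ) (z : Spacetime) : ℝ :=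
  ∑ ν, partialD ν (F ν) z

/-- `f` vanishes at all events with time in `I` and position outside `K`. With `K` compact this
makes spatial integrals of continuous fields finite, without boundary terms. -/
def VanishesOff (K : Set Space) (I : Set ℝ) (f : Spacetime → ℝ) : Prop :=
  ∀ t ∈ I, ∀ x ∉ K, f (t, x) = 0

lemma future_mem_nhds (hz : 0 < z.1) : Future ∈ 𝓝 z :=
  mem_of_superset ((isOpen_Ioi.prod isOpen_univ).mem_nhds
    (show z ∈ Ioi 0 ×ˢ univ from ⟨hz, trivial⟩)) (prod_mono_left Ioi_subset_Ici_self)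

lemma differentiableAt_of_contDiffOn_future {G : Type*} [NormedAddCommGroup G] [NormedSpace ℝ G]
    {f : Spacetime → G} (hf : ContDiffOn ℝ 1 f Future) (hz : 0 < z.1) : DifferentiableAt ℝ f z :=
  (hf.contDiffAt (future_mem_nhds hz)).differentiableAt one_ne_zero

lemma continuousOn_partialD (hf : ContDiffOn ℝ 1 f Future) (ν : Fin 4) :
    ContinuousOn (partialD ν f) (Ioi 0 ×ˢ univ) :=
  ((hf.mono (prod_mono_left Ioi_subset_Ici_self)).continuousOn_fderiv_of_isOpen
    (isOpen_Ioi.prod isOpen_univ) le_rfl).clm_apply continuousOn_const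

lemma continuous_slice {G : Type*} [TopologicalSpace G] {f : Spacetime → G}
    (hf : ContinuousOn f Future) (ht : 0 ≤ t) : Continuous fun x : Space => f (t, x) :=
  hf.comp_continuous (by fun_prop) fun _ => ⟨ht, trivial⟩

lemma continuous_partialD_slice (hf : ContDiffOn ℝ 1 f Future) (ht : 0 < t) (ν : Fin 4) :
    Continuous fun x : Space => partialD ν f (t, x) :=
  (continuousOn_partialD hf ν).comp_continuous (by fun_prop) fun _ => ⟨ht, trivial⟩

lemma coordVec_zero : coordVec 0 = ((1 : ℝ), (0 : Space)) := rfl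

lemma coordVec_succ (i : Fin 3) :
    coordVec i.succ = ((0 : ℝ), (EuclideanSpace.single i (1 : ℝ) : Space)) := rfl

lemma sum_smul_coordVec (a : Fin 4 → ℝ) :
    ∑ ν, a ν • coordVec ν = (a 0, WithLp.toLp 2 (Fin.tail a)) := by
  rw [Fin.sum_univ_succ, coordVec_zero]
  simp only [coordVec_succ]
  ext i
  · simp [Prod.fst_sum]
  · fin_cases i <;> simp [Fin.sum_univ_three, Fin.tail]

lemma sum_mul_partialD (a : Fin 4 → ℝ) (f : Spacetime → ℝ) (z : Spacetime) :
    ∑ ν, a ν * partialD ν f z = fderiv ℝ f z (a 0, WithLp.toLp 2 (Fin.tail a)) := by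
  simp only [← sum_smul_coordVec, map_sum, map_smul, smul_eq_mul, partialD]

lemma partialD_mul (hf : DifferentiableAt ℝ f z) (hg : DifferentiableAt ℝ g z) (ν : Fin 4) :
    partialD ν (fun y => f y * g y) z = partialD ν f z * g z + f z * partialD ν g z := by
  simp only [partialD, fderiv_fun_mul hf hg, add_apply, smul_apply, smul_eq_mul]
  ring

lemma partialD_add (hf : DifferentiableAt ℝ f z) (hg : DifferentiableAt ℝ g z) (ν : Fin 4) :
    partialD ν (fun y => f y + g y) z = partialD ν f z + partialD ν g z := by
  simp only [partialD, fderiv_fun_add hf hg, add_apply]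

lemma divergence_add {G : Fin 4 → Spacetime → ℝ} (hF : ∀ ν, DifferentiableAt ℝ (F ν) z)
    (hG : ∀ ν, DifferentiableAt ℝ (G ν) z) :
    divergence (fun ν y => F ν y + G ν y) z = divergence F z + divergence G z := by
  simp only [divergence, partialD_add (hF _) (hG _), Finset.sum_add_distrib]

lemma divergence_sub {G : Fin 4 → Spacetime → ℝ} (hF : ∀ ν, DifferentiableAt ℝ (F ν) z)
    (hG : ∀ ν, DifferentiableAt ℝ (G ν) z) :
    divergence (fun ν y => F ν y - G ν y) z = divergence F z - divergence G z := by
  simp only [divergence, partialD, fderiv_fun_sub (hF _) (hG _), sub_apply,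
    Finset.sum_sub_distrib]

lemma divergence_const (a : Fin 4 → ℝ) : divergence (fun ν _ => a ν) z = 0 := by
  simp [divergence, partialD]

lemma divergence_mul (hf : DifferentiableAt ℝ f z) (hF : ∀ ν, DifferentiableAt ℝ (F ν) z) :
    divergence (fun ν y => f y * F ν y) z =
      ∑ ν, F ν z * partialD ν f z + f z * divergence F z := by
  simp only [divergence, partialD_mul hf (hF _), Finset.sum_add_distrib, Finset.mul_sum, mul_comm]

lemma hasFDerivAt_slice (hf : ContDiffOn ℝ 1 f Future) (ht : 0 < t) (x : Space) :
    HasFDerivAt (fun y : Space => f (t, y))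
      ((fderiv ℝ f (t, x)).comp (ContinuousLinearMap.inr ℝ ℝ Space)) x :=
  (differentiableAt_of_contDiffOn_future (z := (t, x)) hf ht).hasFDerivAt.comp x
    (hasFDerivAt_prodMk_right t x)

lemma fderiv_slice_single (hf : ContDiffOn ℝ 1 f Future) (ht : 0 < t) (x : Space) (i : Fin 3) :
    fderiv ℝ (fun y : Space => f (t, y)) x (EuclideanSpace.single i 1) =
      partialD i.succ f (t, x) := by
  rw [(hasFDerivAt_slice hf ht x).fderiv]
  rfl

lemma hasDerivAt_time (hf : ContDiffOn ℝ 1 f Future) (ht : 0 < t) (x : Space) :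
    HasDerivAt (fun τ => f (τ, x)) (partialD 0 f (t, x)) t :=
  ((differentiableAt_of_contDiffOn_future (z := (t, x)) hf ht).hasFDerivAt.comp (f := (·, x)) t
    (hasFDerivAt_prodMk_left t x)).hasDerivAt

lemma VanishesOff.partialD_eq_zero (hf : VanishesOff K I f) (hK : IsClosed K) (hI : I ∈ 𝓝 t)
    {x : Space} (hx : x ∉ K) (ν : Fin 4) : partialD ν f (t, x) = 0 := by
  have h : f =ᶠ[𝓝 (t, x)] fun _ => 0 := by
    filter_upwards [prod_mem_nhds hI (hK.isOpen_compl.mem_nhds hx)] with z hz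
    exact hf z.1 hz.1 z.2 hz.2
  simp [partialD, h.fderiv_eq]

lemma VanishesOff.hasCompactSupport (hf : VanishesOff K I f) (hK : IsCompact K) (ht : t ∈ I) :
    HasCompactSupport fun x => f (t, x) :=
  HasCompactSupport.intro hK (hf t ht)

lemma VanishesOff.integrable (hf : VanishesOff K I f) (hK : IsCompact K)
    (hfc : ContinuousOn f Future) (ht0 : 0 ≤ t) (ht : t ∈ I) : Integrable fun x => f (t, x) :=
  (continuous_slice hfc ht0).integrable_of_hasCompactSupport (hf.hasCompactSupport hK ht)

lemma VanishesOff.continuousOn_integral (hf : VanishesOff K I f) (hK : IsCompact K)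
    (hfc : ContinuousOn f Future) (hI : I ⊆ Ici 0) :
    ContinuousOn (fun t => ∫ x, f (t, x)) I :=
  continuousOn_integral_of_compact_support (f := fun t x => f (t, x)) hK
    (hfc.mono (prod_mono_left hI)) fun t x ht hx => hf t ht x hx

lemma VanishesOff.integral_partialD_succ (hf : VanishesOff K I f) (hK : IsCompact K)
    (hfd : ContDiffOn ℝ 1 f Future) (ht0 : 0 < t) (ht : t ∈ I) (i : Fin 3) :
    ∫ x, partialD i.succ f (t, x) = 0 := by
  have hc := continuous_partialD_slice hfd ht0 i.succ
  simp only [← fderiv_slice_single hfd ht0] at hc ⊢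
  exact integral_fderiv_eq_zero (fun x => (hasFDerivAt_slice hfd ht0 x).differentiableAt) _ hc
    (hf.hasCompactSupport hK ht)

lemma VanishesOff.hasDerivAt_integral (hf : VanishesOff K I f) (hK : IsCompact K)
    (hfd : ContDiffOn ℝ 1 f Future) (ht0 : 0 < t) (ht : I ∈ 𝓝 t) :
    HasDerivAt (fun t => ∫ x, f (t, x)) (∫ x, partialD 0 f (t, x)) t := by
  obtain ⟨a, b, -, hnhds, hsub⟩ := exists_Icc_mem_subset_of_mem_nhds
    (inter_mem (Ioi_mem_nhds ht0) (interior_mem_nhds.2 ht))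
  obtain ⟨C, hC⟩ := (isCompact_Icc.prod hK).exists_bound_of_continuousOn
    ((continuousOn_partialD hfd 0).mono (prod_mono (fun τ hτ => (hsub hτ).1) (subset_univ _)))
  refine (hasDerivAt_integral_of_dominated_loc_of_deriv_le (F := fun t x => f (t, x))
    (F' := fun t x => partialD 0 f (t, x)) (bound := K.indicator fun _ => C) hnhds
    ?_ (hf.integrable hK hfd.continuousOn ht0.le (mem_of_mem_nhds ht)) ?_ ?_ ?_ ?_).2
  · filter_upwards [Ioi_mem_nhds ht0] with τ hτ
    exact (continuous_slice hfd.continuousOn (le_of_lt hτ)).aestronglyMeasurable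
  · exact (continuous_partialD_slice hfd ht0 0).aestronglyMeasurable
  · refine Eventually.of_forall fun x τ hτ => ?_
    by_cases hx : x ∈ K
    · rw [indicator_of_mem hx]
      exact hC (τ, x) ⟨hτ, hx⟩
    · rw [indicator_of_notMem hx,
        hf.partialD_eq_zero hK.isClosed (mem_interior_iff_mem_nhds.1 (hsub hτ).2) hx, norm_zero]
  · exact (integrable_indicator_iff hK.measurableSet).2
      (integrableOn_const hK.measure_lt_top.ne)
  · exact Eventually.of_forall fun x τ hτ => hasDerivAt_time hfd (hsub hτ).1 x

lemma hasDerivAt_integral_divergence (hFK : ∀ ν, VanishesOff K I (F ν)) (hK : IsCompact K)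
    (hF : ∀ ν, ContDiffOn ℝ 1 (F ν) Future) (ht0 : 0 < t) (ht : I ∈ 𝓝 t) :
    HasDerivAt (fun t => ∫ x, F 0 (t, x)) (∫ x, divergence F (t, x)) t := by
  have hint : ∀ ν, Integrable fun x : Space => partialD ν (F ν) (t, x) := fun ν =>
    (continuous_partialD_slice (hF ν) ht0 ν).integrable_of_hasCompactSupport
      (HasCompactSupport.intro hK fun x hx => (hFK ν).partialD_eq_zero hK.isClosed ht hx ν)
  have hflux : ∫ x, divergence F (t, x) = ∫ x, partialD 0 (F 0) (t, x) := by
    simp only [divergence]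
    rw [integral_finsetSum _ fun ν _ => hint ν, Fin.sum_univ_succ, Finset.sum_eq_zero, add_zero]
    exact fun i _ => (hFK i.succ).integral_partialD_succ hK (hF i.succ) ht0 (mem_of_mem_nhds ht) i
  rw [hflux]
  exact (hFK 0).hasDerivAt_integral hK (hF 0) ht0 ht

lemma integral_slice_eq_of_divergence_eq_zero {T : ℝ} (hFK : ∀ ν, VanishesOff K (Icc 0 T) (F ν))
    (hK : IsCompact K) (hF : ∀ ν, ContDiffOn ℝ 1 (F ν) Future)
    (hdiv : ∀ z : Spacetime, 0 < z.1 → divergence F z = 0) (hT : 0 ≤ T) :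
    ∫ x, F 0 (T, x) = ∫ x, F 0 (0, x) := by
  rcases hT.eq_or_lt with rfl | hT
  · rfl
  obtain ⟨t, -, hslope⟩ := exists_hasDerivAt_eq_slope (fun t => ∫ x, F 0 (t, x)) (fun _ => 0) hT
    ((hFK 0).continuousOn_integral hK (hF 0).continuousOn Icc_subset_Ici_self) fun t ht => by
      simpa [hdiv (t, _) ht.1] using
        hasDerivAt_integral_divergence hFK hK hF ht.1 (Icc_mem_nhds ht.1 ht.2)
  rw [eq_comm, div_eq_zero_iff, sub_eq_zero] at hslope
  exact hslope.resolve_right (sub_pos.2 hT).ne'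

end Spacetime

/-! ### Flux through backward cones -/

section ConservedCurrents

variable {c t₁ τ : ℝ} {x₁ : Space} {z : Spacetime} {j : Fin 4 → ℝ} {J : Fin 4 → Spacetime → ℝ}

/-- The spatial part of a four-vector given by its components. -/
def spatial (j : Fin 4 → ℝ) : Space := WithLp.toLp 2 (Fin.tail j)

/-- The four-vector `j` is future-directed and its speed is at most `c`: this is how a current must
point for its flux through the backward cones of slope `c` to have a sign. -/
def IsCausal (c : ℝ) (j : Fin 4 → ℝ) : Prop := ‖spatial j‖ ≤ c * j 0

/-- The open backward cone of slope `c` with tip `(t₁, x₁)`, cut off before the time `τ`. -/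
def openCone (c τ t₁ : ℝ) (x₁ : Space) : Set Spacetime :=
  {z | z.1 ∈ Icc τ t₁ ∧ ‖z.2 - x₁‖ < c * (t₁ - z.1)}

/-- The quadratic function whose positivity region before `t₁` is the open backward cone of slope
`c` with tip `(t₁, x₁)`. -/
def coneFun (c t₁ : ℝ) (x₁ : Space) (z : Spacetime) : ℝ :=
  c ^ 2 * (t₁ - z.1) ^ 2 - ‖z.2 - x₁‖ ^ 2

/-- A smooth weight that is positive exactly in the open backward cone, at times before `t₁`. -/
def coneWeight (c t₁ : ℝ) (x₁ : Space) (z : Spacetime) : ℝ :=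
  expNegInvGlue (coneFun c t₁ x₁ z)

lemma IsCausal.zero_nonneg (hc : 0 < c) (hj : IsCausal c j) : 0 ≤ j 0 :=
  nonneg_of_mul_nonneg_right ((norm_nonneg _).trans hj) hc

lemma contDiff_coneFun : ContDiff ℝ 1 (coneFun c t₁ x₁) := by
  unfold coneFun
  exact (contDiff_const.mul ((contDiff_const.sub contDiff_fst).pow 2)).sub
    ((contDiff_snd.sub contDiff_const).norm_sq ℝ)

lemma contDiff_coneWeight : ContDiff ℝ 1 (coneWeight c t₁ x₁) :=
  (expNegInvGlue.contDiff (n := 1)).comp contDiff_coneFun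

lemma fderiv_coneFun (z w : Spacetime) :
    fderiv ℝ (coneFun c t₁ x₁) z w =
      -(2 * c ^ 2 * (t₁ - z.1) * w.1) - 2 * inner ℝ (z.2 - x₁) w.2 := by
  have hspace : HasFDerivAt (fun z : Spacetime => ‖z.2 - x₁‖ ^ 2) _ z :=
    ((hasFDerivAt_snd (𝕜 := ℝ) (p := z)).sub_const x₁).norm_sq
  have htime : HasFDerivAt (fun z : Spacetime => c ^ 2 * (t₁ - z.1) ^ 2) _ z :=
    (((hasFDerivAt_fst (𝕜 := ℝ) (p := z)).const_sub t₁).pow 2).const_mul (c ^ 2)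
  have hcone : HasFDerivAt (coneFun c t₁ x₁) _ z := htime.sub hspace
  rw [hcone.fderiv]
  simp [inner_sub_left]
  ring

lemma coneFun_pos_iff (hc : 0 ≤ c) (hz : z.1 ≤ t₁) :
    0 < coneFun c t₁ x₁ z ↔ ‖z.2 - x₁‖ < c * (t₁ - z.1) := by
  rw [coneFun, sub_pos, ← mul_pow]
  exact pow_lt_pow_iff_left₀ (norm_nonneg _) (mul_nonneg hc (sub_nonneg.2 hz)) two_ne_zero

lemma coneFun_pos_of_mem_openCone (hc : 0 ≤ c) (hz : z ∈ openCone c τ t₁ x₁) :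
    0 < coneFun c t₁ x₁ z :=
  (coneFun_pos_iff hc hz.1.2).2 hz.2

lemma coneWeight_eq_zero (hc : 0 ≤ c) (hz : z.1 ∈ Icc τ t₁) (hzc : z ∉ openCone c τ t₁ x₁) :
    coneWeight c t₁ x₁ z = 0 :=
  expNegInvGlue.zero_of_nonpos (not_lt.1 fun h => hzc ⟨hz, (coneFun_pos_iff hc hz.2).1 h⟩)

lemma deriv_expNegInvGlue_nonneg (y : ℝ) : 0 ≤ deriv expNegInvGlue y :=
  expNegInvGlue.monotone.deriv_nonneg

lemma deriv_expNegInvGlue_of_nonpos {y : ℝ} (hy : y ≤ 0) : deriv expNegInvGlue y = 0 := by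
  refine IsLocalMin.deriv_eq_zero (Eventually.of_forall fun w => ?_)
  rw [expNegInvGlue.zero_of_nonpos hy]
  exact expNegInvGlue.nonneg w

lemma fderiv_coneWeight (z w : Spacetime) :
    fderiv ℝ (coneWeight c t₁ x₁) z w =
      deriv expNegInvGlue (coneFun c t₁ x₁ z) * fderiv ℝ (coneFun c t₁ x₁) z w := by
  have hglue : HasDerivAt expNegInvGlue _ (coneFun c t₁ x₁ z) :=
    ((expNegInvGlue.contDiff (n := 1)).differentiable one_ne_zero _).hasDerivAt
  have hcone : HasFDerivAt (coneFun c t₁ x₁) _ z :=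
    (contDiff_coneFun.differentiable one_ne_zero z).hasFDerivAt
  have hweight : HasFDerivAt (coneWeight c t₁ x₁) _ z := hglue.comp_hasFDerivAt z hcone
  simp [hweight.fderiv]

lemma fderiv_coneFun_nonpos_of_isCausal (hz : z ∈ openCone c τ t₁ x₁) (hj : IsCausal c j) :
    fderiv ℝ (coneFun c t₁ x₁) z (j 0, spatial j) ≤ 0 := by
  have hflux : -inner ℝ (z.2 - x₁) (spatial j) ≤ c * (t₁ - z.1) * (c * j 0) :=
    ((neg_le_abs _).trans (abs_real_inner_le_norm _ _)).trans
      (mul_le_mul hz.2.le hj (norm_nonneg _) ((norm_nonneg _).trans hz.2.le))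
  rw [fderiv_coneFun]
  linarith

lemma fderiv_coneWeight_nonpos (hc : 0 ≤ c) (hz : z.1 ∈ Icc τ t₁)
    (hj : z ∈ openCone c τ t₁ x₁ → IsCausal c j) :
    fderiv ℝ (coneWeight c t₁ x₁) z (j 0, spatial j) ≤ 0 := by
  rw [fderiv_coneWeight]
  by_cases hzc : z ∈ openCone c τ t₁ x₁
  · exact mul_nonpos_of_nonneg_of_nonpos (deriv_expNegInvGlue_nonneg _)
      (fderiv_coneFun_nonpos_of_isCausal hzc (hj hzc))
  · rw [deriv_expNegInvGlue_of_nonpos, zero_mul]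
    exact not_lt.1 fun h => hzc ⟨hz, (coneFun_pos_iff hc hz.2).1 h⟩

lemma vanishesOff_coneWeight_mul (hc : 0 ≤ c) (f : Spacetime → ℝ) :
    VanishesOff (Metric.closedBall x₁ (c * (t₁ - τ))) (Icc τ t₁)
      fun z => coneWeight c t₁ x₁ z * f z := by
  intro t ht x hx
  refine mul_eq_zero_of_left (coneWeight_eq_zero hc ht ?_) _
  refine fun h => hx (mem_closedBall_iff_norm.2 (h.2.le.trans ?_))
  exact mul_le_mul_of_nonneg_left (sub_le_sub_left ht.1 _) hc

/-- The weight is chosen so that the boundary flux of the current becomes the bulk term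
`J^ν ∂_ν w`, which is nonpositive for a causal current. -/
lemma antitoneOn_integral_coneWeight_mul (hc : 0 ≤ c) (hτ : 0 ≤ τ)
    (hJ : ∀ ν, ContDiffOn ℝ 1 (J ν) Future)
    (hdiv : ∀ z : Spacetime, 0 < z.1 → divergence J z = 0)
    (hcausal : ∀ z ∈ openCone c τ t₁ x₁, IsCausal c fun ν => J ν z) :
    AntitoneOn (fun t => ∫ x, coneWeight c t₁ x₁ (t, x) * J 0 (t, x)) (Icc τ t₁) := by
  have hK : IsCompact (Metric.closedBall x₁ (c * (t₁ - τ))) := isCompact_closedBall _ _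
  have hWJ : ∀ ν, ContDiffOn ℝ 1 (fun z => coneWeight c t₁ x₁ z * J ν z) Future :=
    fun ν => contDiff_coneWeight.contDiffOn.mul (hJ ν)
  have hderiv : ∀ t ∈ Ioo τ t₁, HasDerivAt (fun t => ∫ x, coneWeight c t₁ x₁ (t, x) * J 0 (t, x))
      (∫ x, divergence (fun ν z => coneWeight c t₁ x₁ z * J ν z) (t, x)) t := fun t ht =>
    hasDerivAt_integral_divergence (fun ν => vanishesOff_coneWeight_mul hc (J ν)) hK hWJ
      (hτ.trans_lt ht.1) (Icc_mem_nhds ht.1 ht.2)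
  refine antitoneOn_of_hasDerivWithinAt_nonpos (convex_Icc τ t₁)
    ((vanishesOff_coneWeight_mul hc (J 0)).continuousOn_integral hK (hWJ 0).continuousOn
      fun t ht => hτ.trans ht.1)
    (fun t ht => (hderiv t (interior_Icc (a := τ) ▸ ht)).hasDerivWithinAt) fun t ht => ?_
  rw [interior_Icc] at ht
  refine integral_nonpos fun x => ?_
  have ht0 : 0 < t := hτ.trans_lt ht.1
  rw [divergence_mul (contDiff_coneWeight.differentiable one_ne_zero _)
    (fun ν => differentiableAt_of_contDiffOn_future (hJ ν) ht0), hdiv _ ht0, mul_zero, add_zero,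
    sum_mul_partialD (fun ν => J ν (t, x))]
  exact fderiv_coneWeight_nonpos hc (Ioo_subset_Icc_self ht) (hcausal (t, x))

lemma eq_zero_of_isCausal_of_divergence_eq_zero (hc : 0 < c) (hτ : 0 ≤ τ)
    (hJ : ∀ ν, ContDiffOn ℝ 1 (J ν) Future)
    (hdiv : ∀ z : Spacetime, 0 < z.1 → divergence J z = 0)
    (hcausal : ∀ z ∈ openCone c τ t₁ x₁, IsCausal c fun ν => J ν z)
    (hbase : ∀ x, (τ, x) ∈ openCone c τ t₁ x₁ → J 0 (τ, x) = 0)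
    (hz : z ∈ openCone c τ t₁ x₁) : J 0 z = 0 := by
  obtain ⟨t, x⟩ := z
  have ht : t ∈ Icc τ t₁ := hz.1
  have hτt₁ : τ ∈ Icc τ t₁ := left_mem_Icc.2 (ht.1.trans ht.2)
  have hdensity : ∀ y, 0 ≤ coneWeight c t₁ x₁ (t, y) * J 0 (t, y) := by
    intro y
    by_cases hy : (t, y) ∈ openCone c τ t₁ x₁
    · exact mul_nonneg (expNegInvGlue.nonneg _) ((hcausal _ hy).zero_nonneg hc)
    · rw [coneWeight_eq_zero hc.le ht hy, zero_mul]
  have hinitial : ∫ y, coneWeight c t₁ x₁ (τ, y) * J 0 (τ, y) = 0 := by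
    refine (integral_congr_ae (ae_of_all _ fun y => ?_)).trans (integral_zero _ _)
    by_cases hy : (τ, y) ∈ openCone c τ t₁ x₁
    · simp only [hbase y hy, mul_zero]
    · simp only [coneWeight_eq_zero hc.le hτt₁ hy, zero_mul]
  by_contra hne
  refine ((antitoneOn_integral_coneWeight_mul hc.le hτ hJ hdiv hcausal hτt₁ ht ht.1).trans
    hinitial.le).not_gt ?_
  refine Continuous.integral_pos_of_hasCompactSupport_nonneg_nonzero (x := x)
    (continuous_slice (f := fun z => coneWeight c t₁ x₁ z * J 0 z)
      (contDiff_coneWeight.contDiffOn.mul (hJ 0)).continuousOn (hτ.trans ht.1))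
    ((vanishesOff_coneWeight_mul hc.le (J 0)).hasCompactSupport (isCompact_closedBall _ _) ht)
    hdensity (mul_ne_zero ?_ hne)
  exact (expNegInvGlue.pos_of_pos (coneFun_pos_of_mem_openCone hc.le hz)).ne'

end ConservedCurrents

/-! ### Thermodynamics -/

section Thermodynamics

/-- The enthalpy per particle `h = ∂ρ/∂n = (ρ + p)/n`. -/
def enthalpy (ρ : ℝ → ℝ → ℝ) (n s : ℝ) : ℝ := deriv (fun m => ρ m s) n

/-- The energy density relative to the density `N` on the isentrope `s`: the part of `ρ` that is
of second order at `N`. -/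
def relativeEnergy (ρ : ℝ → ℝ → ℝ) (N s n : ℝ) : ℝ :=
  ρ n s - ρ N s - enthalpy ρ N s * (n - N)

variable {ρ : ℝ → ℝ → ℝ} {N S n s : ℝ}

lemma rho_add_pressure (n s : ℝ) : ρ n s + pressure ρ n s = n * enthalpy ρ n s :=
  add_sub_cancel _ _

namespace IsEquationOfState

lemma enthalpy_pos (hρ : IsEquationOfState ρ) (hn : 0 < n) (hs : 0 ≤ s) : 0 < enthalpy ρ n s :=
  hρ.deriv_rho_pos n s hn hs

lemma contDiffOn_isentropic (hρ : IsEquationOfState ρ) (hs : 0 ≤ s) :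
    ContDiffOn ℝ 2 (fun m => ρ m s) (Ioi 0) :=
  hρ.contDiffOn.comp (f := fun m : ℝ => (m, s)) (by fun_prop) fun _ hm => ⟨hm, hs⟩

lemma contDiffOn_enthalpy (hρ : IsEquationOfState ρ) (hs : 0 ≤ s) :
    ContDiffOn ℝ 1 (fun m => enthalpy ρ m s) (Ioi 0) :=
  ((contDiffOn_succ_iff_deriv_of_isOpen (n := 1) isOpen_Ioi).1
    (hρ.contDiffOn_isentropic hs)).2.2

lemma hasDerivAt_rho (hρ : IsEquationOfState ρ) (hn : 0 < n) (hs : 0 ≤ s) :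
    HasDerivAt (fun m => ρ m s) (enthalpy ρ n s) n :=
  (((hρ.contDiffOn_isentropic hs).contDiffAt (Ioi_mem_nhds hn)).differentiableAt
    two_ne_zero).hasDerivAt

lemma hasDerivAt_enthalpy (hρ : IsEquationOfState ρ) (hn : 0 < n) (hs : 0 ≤ s) :
    HasDerivAt (fun m => enthalpy ρ m s) (deriv (fun m => enthalpy ρ m s) n) n :=
  (((hρ.contDiffOn_enthalpy hs).contDiffAt (Ioi_mem_nhds hn)).differentiableAt
    one_ne_zero).hasDerivAt

lemma hasDerivAt_pressure (hρ : IsEquationOfState ρ) (hn : 0 < n) (hs : 0 ≤ s) :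
    HasDerivAt (fun m => pressure ρ m s) (n * deriv (fun m => enthalpy ρ m s) n) n :=
  (((hasDerivAt_id n).mul (hρ.hasDerivAt_enthalpy hn hs)).sub
    (hρ.hasDerivAt_rho hn hs)).congr_deriv (by simp)

lemma continuousOn_pressure (hρ : IsEquationOfState ρ) (hs : 0 ≤ s) :
    ContinuousOn (fun m => pressure ρ m s) (Ioi 0) :=
  fun _ hm => (hρ.hasDerivAt_pressure hm hs).continuousAt.continuousWithinAt

lemma mul_deriv_enthalpy_pos (hρ : IsEquationOfState ρ) (hn : 0 < n) (hs : 0 ≤ s) :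
    0 < n * deriv (fun m => enthalpy ρ m s) n :=
  (hρ.hasDerivAt_pressure hn hs).deriv ▸ hρ.deriv_pressure_pos n s hn hs

lemma deriv_enthalpy_pos (hρ : IsEquationOfState ρ) (hn : 0 < n) (hs : 0 ≤ s) :
    0 < deriv (fun m => enthalpy ρ m s) n :=
  pos_of_mul_pos_right (hρ.mul_deriv_enthalpy_pos hn hs) hn.le

lemma strictMonoOn_pressure (hρ : IsEquationOfState ρ) (hs : 0 ≤ s) :
    StrictMonoOn (fun m => pressure ρ m s) (Ioi 0) :=
  strictMonoOn_of_deriv_pos (convex_Ioi 0) (hρ.continuousOn_pressure hs) fun m hm =>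
    hρ.deriv_pressure_pos m s (interior_subset hm) hs

lemma strictMonoOn_enthalpy (hρ : IsEquationOfState ρ) (hs : 0 ≤ s) :
    StrictMonoOn (fun m => enthalpy ρ m s) (Ioi 0) :=
  strictMonoOn_of_deriv_pos (convex_Ioi 0) (hρ.contDiffOn_enthalpy hs).continuousOn fun _ hm =>
    hρ.deriv_enthalpy_pos (interior_subset hm) hs

lemma pressure_pos (hρ : IsEquationOfState ρ) (hn : 0 < n) (hs : 0 ≤ s) : 0 < pressure ρ n s :=
  (hρ.pressure_nonneg (n / 2) s (half_pos hn).le hs).trans_lt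
    (hρ.strictMonoOn_pressure hs (mem_Ioi.2 (half_pos hn)) hn (half_lt_self hn))

lemma rho_vacuum (hρ : IsEquationOfState ρ) (hs : 0 ≤ s) : ρ 0 s = 0 := by
  have hp := hρ.pressure_nonneg 0 s le_rfl hs
  rw [pressure, zero_mul, zero_sub] at hp
  exact le_antisymm (neg_nonneg.1 hp) (hρ.rho_nonneg 0 s le_rfl hs)

lemma pressure_vacuum (hρ : IsEquationOfState ρ) (hs : 0 ≤ s) : pressure ρ 0 s = 0 := by
  simp [pressure, hρ.rho_vacuum hs]

/-- Otherwise `n ∂ρ/∂n = ρ + p` would be bounded below and `ρ` would decrease logarithmically to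
`-∞` at vacuum. -/
lemma exists_rho_add_pressure_lt (hρ : IsEquationOfState ρ) (hs : 0 ≤ s) {a : ℝ} (ha : 0 < a) :
    ∃ n, 0 < n ∧ ρ n s + pressure ρ n s < a := by
  by_contra! H
  set x := Real.exp (-((ρ 1 s + 1) / a))
  have hx : 0 < x := Real.exp_pos _
  have hx1 : x ≤ 1 := Real.exp_le_one_iff.2
    (neg_nonpos.2 (div_nonneg (by linarith [hρ.rho_nonneg 1 s zero_le_one hs]) ha.le))
  have hlog := mul_log_sub_log_le_sub hx hx1
    (fun m hm => hρ.hasDerivAt_rho (hx.trans_le hm.1) hs)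
    fun m hm => (H m (hx.trans_le hm.1)).trans_eq (rho_add_pressure m s)
  rw [Real.log_one, Real.log_exp, zero_sub, neg_neg, mul_div_cancel₀ _ ha.ne'] at hlog
  linarith [hρ.rho_nonneg x s hx.le hs]

lemma soundSpeed_pos (hρ : IsEquationOfState ρ) (hn : 0 < n) (hs : 0 ≤ s) :
    0 < soundSpeed ρ n s :=
  Real.sqrt_pos.2 (div_pos (hρ.deriv_pressure_pos n s hn hs) (hρ.deriv_rho_pos n s hn hs))

lemma soundSpeed_sq_mul_enthalpy (hρ : IsEquationOfState ρ) (hn : 0 < n) (hs : 0 ≤ s) :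
    soundSpeed ρ n s ^ 2 * enthalpy ρ n s = n * deriv (fun m => enthalpy ρ m s) n := by
  rw [soundSpeed, Real.sq_sqrt (div_nonneg (hρ.deriv_pressure_pos n s hn hs).le
    (hρ.deriv_rho_pos n s hn hs).le), (hρ.hasDerivAt_pressure hn hs).deriv]
  exact div_mul_cancel₀ _ (hρ.enthalpy_pos hn hs).ne'

lemma monotoneOn_soundSpeed_sq (hρ : IsEquationOfState ρ) (hA2 : SoundSpeedMonotoneInPressure ρ)
    (hs : 0 ≤ s) : MonotoneOn (fun m => soundSpeed ρ m s ^ 2) (Ioi 0) := fun m hm m' hm' h =>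
  pow_le_pow_left₀ (hρ.soundSpeed_pos hm hs).le
    (hA2 m m' s hm hm' hs ((hρ.strictMonoOn_pressure hs).monotoneOn hm hm' h)) 2

/-- The logarithmic derivative `n ∂p/∂n = η² n h` is bounded below away from vacuum. -/
lemma exists_le_pressure (hρ : IsEquationOfState ρ) (hA2 : SoundSpeedMonotoneInPressure ρ)
    (hs : 0 ≤ s) (P : ℝ) : ∃ n, 0 < n ∧ P ≤ pressure ρ n s := by
  set k := soundSpeed ρ 1 s ^ 2 * enthalpy ρ 1 s
  have hk : 0 < k := mul_pos (pow_pos (hρ.soundSpeed_pos one_pos hs) 2) (hρ.enthalpy_pos one_pos hs)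
  have hbound : ∀ m, 1 ≤ m → k ≤ m * (m * deriv (fun m => enthalpy ρ m s) m) := by
    intro m hm
    have hm0 : 0 < m := one_pos.trans_le hm
    have hη : soundSpeed ρ 1 s ^ 2 ≤ soundSpeed ρ m s ^ 2 :=
      hρ.monotoneOn_soundSpeed_sq hA2 hs (mem_Ioi.2 one_pos) hm0 hm
    have hh : enthalpy ρ 1 s ≤ enthalpy ρ m s :=
      (hρ.strictMonoOn_enthalpy hs).monotoneOn (mem_Ioi.2 one_pos) hm0 hm
    rw [← hρ.soundSpeed_sq_mul_enthalpy hm0 hs]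
    have hkm := mul_le_mul hη hh (hρ.enthalpy_pos one_pos hs).le (sq_nonneg _)
    exact hkm.trans (le_mul_of_one_le_left (hk.le.trans hkm) hm)
  have hy : 1 ≤ Real.exp (|P| / k) := Real.one_le_exp (div_nonneg (abs_nonneg P) hk.le)
  have hlog := mul_log_sub_log_le_sub one_pos hy
    (fun m hm => hρ.hasDerivAt_pressure (one_pos.trans_le hm.1) hs) fun m hm => hbound m hm.1
  rw [Real.log_one, sub_zero, Real.log_exp, mul_div_cancel₀ _ hk.ne'] at hlog
  exact ⟨_, Real.exp_pos _,
    by linarith [le_abs_self P, hρ.pressure_nonneg 1 s zero_le_one hs]⟩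

lemma surjOn_pressure (hρ : IsEquationOfState ρ) (hA2 : SoundSpeedMonotoneInPressure ρ)
    (hs : 0 ≤ s) : SurjOn (fun m => pressure ρ m s) (Ioi 0) (Ioi 0) := by
  intro P hP
  obtain ⟨a, ha, haP⟩ := hρ.exists_rho_add_pressure_lt hs hP
  obtain ⟨b, hb, hbP⟩ := hρ.exists_le_pressure hA2 hs P
  exact isPreconnected_Ioi.intermediate_value ha hb (hρ.continuousOn_pressure hs)
    ⟨by linarith [hρ.rho_nonneg a s ha.le hs], hbP⟩

lemma isMinOn_pressure_sub_soundSpeed_sq_mul_rho (hρ : IsEquationOfState ρ)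
    (hA2 : SoundSpeedMonotoneInPressure ρ) (hN : 0 < N) (hs : 0 ≤ s) :
    IsMinOn (fun m => pressure ρ m s - soundSpeed ρ N s ^ 2 * ρ m s) (Ioi 0) N := by
  refine isMinOn_of_sub_mul_hasDerivAt_nonneg (f' := fun m =>
    (soundSpeed ρ m s ^ 2 - soundSpeed ρ N s ^ 2) * enthalpy ρ m s) ordConnected_Ioi hN
    (fun m hm => ?_) fun m hm => ?_
  · refine ((hρ.hasDerivAt_pressure hm hs).sub
      ((hρ.hasDerivAt_rho hm hs).const_mul _)).congr_deriv ?_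
    rw [← hρ.soundSpeed_sq_mul_enthalpy hm hs, sub_mul]
  · rw [← mul_assoc]
    refine mul_nonneg ?_ (hρ.enthalpy_pos hm hs).le
    have hη := hρ.monotoneOn_soundSpeed_sq hA2 hs
    rcases le_total N m with h | h
    · exact mul_nonneg (sub_nonneg.2 h) (sub_nonneg.2 (hη hN hm h))
    · exact mul_nonneg_of_nonpos_of_nonpos (sub_nonpos.2 h) (sub_nonpos.2 (hη hm hN h))

lemma pressure_le_soundSpeed_sq_mul_rho (hρ : IsEquationOfState ρ)
    (hA2 : SoundSpeedMonotoneInPressure ρ) (hN : 0 < N) (hs : 0 ≤ s) :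
    pressure ρ N s ≤ soundSpeed ρ N s ^ 2 * ρ N s := by
  refine le_of_forall_pos_le_add fun a ha => ?_
  obtain ⟨m, hm, hma⟩ := hρ.exists_rho_add_pressure_lt hs ha
  have hmin := hρ.isMinOn_pressure_sub_soundSpeed_sq_mul_rho hA2 hN hs hm
  have hρm := hρ.rho_nonneg m s hm.le hs
  have hηρ := mul_nonneg (sq_nonneg (soundSpeed ρ N s)) hρm
  simp only [mem_ofPred_eq] at hmin
  linarith

/-- By (A1) the state may be replaced by the one with the same pressure on the isentrope `S`,
along which (A2) gives the inequality. -/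
lemma soundSpeed_sq_mul_rho_sub_le (hρ : IsEquationOfState ρ) (hA1 : RhoAntitoneInEntropy ρ)
    (hA2 : SoundSpeedMonotoneInPressure ρ) (hN : 0 < N) (hS : 0 ≤ S) (hn : 0 ≤ n) (hs : S ≤ s) :
    soundSpeed ρ N S ^ 2 * (ρ n s - ρ N S) ≤ pressure ρ n s - pressure ρ N S := by
  have hs0 := hS.trans hs
  rcases hn.eq_or_lt with rfl | hn
  · rw [hρ.rho_vacuum hs0, hρ.pressure_vacuum hs0]
    linarith [hρ.pressure_le_soundSpeed_sq_mul_rho hA2 hN hS]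
  · obtain ⟨m, hm, hmP⟩ := hρ.surjOn_pressure hA2 hS (mem_Ioi.2 (hρ.pressure_pos hn hs0))
    simp only at hmP
    have hle : soundSpeed ρ N S ^ 2 * ρ n s ≤ soundSpeed ρ N S ^ 2 * ρ m S :=
      mul_le_mul_of_nonneg_left (hA1 m S n s hm hS hn hs0 hmP hs) (sq_nonneg _)
    have hmin := hρ.isMinOn_pressure_sub_soundSpeed_sq_mul_rho hA2 hN hS hm
    simp only [mem_ofPred_eq, hmP] at hmin
    linarith

lemma eventually_sq_enthalpy_sub_le (hρ : IsEquationOfState ρ) (hN : 0 < N) (hs : 0 ≤ s) {κ : ℝ}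
    (hκ : deriv (fun m => enthalpy ρ m s) N < κ) :
    ∀ᶠ n in 𝓝 N, (enthalpy ρ n s - enthalpy ρ N s) ^ 2 ≤ 2 * κ * relativeEnergy ρ N s n := by
  have hcont : ContinuousAt (deriv fun m => enthalpy ρ m s) N :=
    ((hρ.contDiffOn_enthalpy hs).continuousOn_deriv_of_isOpen isOpen_Ioi le_rfl).continuousAt
      (Ioi_mem_nhds hN)
  obtain ⟨δ, hδ, hball⟩ := Metric.eventually_nhds_iff_ball.1
    ((hcont.eventually (Iio_mem_nhds hκ)).and (Ioi_mem_nhds hN))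
  filter_upwards [Metric.ball_mem_nhds N hδ] with n hn
  exact sq_sub_le_two_mul_bregman (convex_ball N δ).ordConnected (Metric.mem_ball_self hδ) hn
    (fun m hm => hρ.hasDerivAt_rho (hball m hm).2 hs)
    (fun m hm => hρ.hasDerivAt_enthalpy (hball m hm).2 hs)
    ((hρ.strictMonoOn_enthalpy hs).monotoneOn.mono fun m hm => (hball m hm).2)
    fun m hm => (hball m hm).1.le

end IsEquationOfState

end Thermodynamics

section RelativeCurrent

variable {ρ : ℝ → ℝ → ℝ} {N S n c κ : ℝ} {v : Space}

lemma fourVel_zero (v : Space) : fourVel v 0 = √(1 + ‖v‖ ^ 2) := rfl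

lemma fourVel_succ (v : Space) (i : Fin 3) : fourVel v i.succ = v i := rfl

lemma one_le_fourVel_zero (v : Space) : 1 ≤ fourVel v 0 :=
  Real.one_le_sqrt.2 (le_add_of_nonneg_right (sq_nonneg _))

lemma fourVel_zero_sq (v : Space) : fourVel v 0 ^ 2 = 1 + ‖v‖ ^ 2 :=
  Real.sq_sqrt (by positivity)

lemma norm_le_fourVel_zero (v : Space) : ‖v‖ ≤ fourVel v 0 :=
  Real.le_sqrt_of_sq_le (le_add_of_nonneg_left zero_le_one)

/-- The energy current relative to the quiet state `(N, S, 0)`: the combination of the currents of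
energy and particle number and a constant that is of second order at the quiet state. -/
def relativeCurrent (ρ : ℝ → ℝ → ℝ) (N S n s : ℝ) (v : Space) (ν : Fin 4) : ℝ :=
  energyTensor ρ n s v 0 ν - enthalpy ρ N S * (n * fourVel v ν) - pressure ρ N S * minkowski 0 ν

lemma relativeCurrent_zero (ρ : ℝ → ℝ → ℝ) (N S n : ℝ) (v : Space) :
    relativeCurrent ρ N S n S v 0 =
      n * (fourVel v 0 - 1) * (enthalpy ρ n S * fourVel v 0 + (enthalpy ρ n S - enthalpy ρ N S)) +
        relativeEnergy ρ N S n := by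
  simp only [relativeCurrent, relativeEnergy, energyTensor, minkowski, if_true, pressure, enthalpy]
  ring

lemma spatial_relativeCurrent (ρ : ℝ → ℝ → ℝ) (N S n : ℝ) (v : Space) :
    spatial (relativeCurrent ρ N S n S v) =
      (n * (enthalpy ρ n S * fourVel v 0 - enthalpy ρ N S)) • v := by
  ext i
  simp only [spatial, Fin.tail, relativeCurrent, energyTensor, rho_add_pressure, minkowski,
    (Fin.succ_ne_zero i).symm, if_false, fourVel_succ, PiLp.smul_apply, smul_eq_mul]
  ring

lemma relativeCurrent_self (ρ : ℝ → ℝ → ℝ) (N S : ℝ) : relativeCurrent ρ N S N S 0 0 = 0 := by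
  simp [relativeCurrent_zero, relativeEnergy, fourVel_zero]

lemma mul_abs_le_add_of_sq_le {a d G : ℝ} (hc : 0 < c) (hκ : 0 < κ) (h : d ^ 2 ≤ 2 * κ * G) :
    a * |d| ≤ c * G + a ^ 2 * κ / (2 * c) := by
  have hsq : 2 * c * κ * (a * |d|) ≤ c ^ 2 * (2 * κ * G) + a ^ 2 * κ ^ 2 := by
    have hd := mul_le_mul_of_nonneg_left h (sq_nonneg c)
    rw [← sq_abs d] at hd
    linarith [sq_nonneg (c * |d| - a * κ)]
  refine le_of_mul_le_mul_left (hsq.trans_eq ?_) (by positivity : 0 < 2 * c * κ)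
  field_simp

/-- With `w = |v|`, this bounds the flux of the relative current by `c` times its density. -/
lemma mul_abs_mul_le_mul_relative_density {n h h' γ w G : ℝ} (hc : 0 < c) (hκ : 0 < κ) (hn : 0 ≤ n)
    (hh : 0 ≤ h) (hγ : 1 ≤ γ) (hw : 0 ≤ w) (hγw : γ ^ 2 = 1 + w ^ 2)
    (hG : (h - h') ^ 2 ≤ 2 * κ * G)
    (hsub : n * κ * (γ + 1) / (2 * c) + w * h ≤ c * (h * γ + (h - h'))) :
    n * |h * γ - h'| * w ≤ c * (n * (γ - 1) * (h * γ + (h - h')) + G) := by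
  have htri : |h * γ - h'| ≤ |h - h'| + h * (γ - 1) := by
    rw [show h * γ - h' = (h - h') + h * (γ - 1) by ring]
    exact (abs_add_le _ _).trans_eq (by rw [abs_of_nonneg (mul_nonneg hh (sub_nonneg.2 hγ))])
  calc n * |h * γ - h'| * w
      ≤ n * (|h - h'| + h * (γ - 1)) * w := by gcongr
    _ = n * w * |h - h'| + n * w * (h * (γ - 1)) := by ring
    _ ≤ c * G + (n * w) ^ 2 * κ / (2 * c) + n * w * (h * (γ - 1)) := by
        gcongr
        exact mul_abs_le_add_of_sq_le hc hκ hG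
    _ = c * G + n * (γ - 1) * (n * κ * (γ + 1) / (2 * c) + w * h) := by
        rw [mul_pow, show w ^ 2 = (γ - 1) * (γ + 1) by linarith]
        ring
    _ ≤ c * G + n * (γ - 1) * (c * (h * γ + (h - h'))) := by
        gcongr
    _ = c * (n * (γ - 1) * (h * γ + (h - h')) + G) := by ring

namespace IsEquationOfState

lemma exists_deriv_enthalpy_lt_and_mul_lt (hρ : IsEquationOfState ρ) (hN : 0 < N) (hS : 0 ≤ S)
    (hc : soundSpeed ρ N S < c) :
    ∃ κ, deriv (fun m => enthalpy ρ m S) N < κ ∧ N * κ < c ^ 2 * enthalpy ρ N S := by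
  have hlt : N * deriv (fun m => enthalpy ρ m S) N < c ^ 2 * enthalpy ρ N S := by
    rw [← hρ.soundSpeed_sq_mul_enthalpy hN hS]
    exact mul_lt_mul_of_pos_right (pow_lt_pow_left₀ hc (hρ.soundSpeed_pos hN hS).le two_ne_zero)
      (hρ.enthalpy_pos hN hS)
  obtain ⟨κ, hκ, hκc⟩ := exists_between ((lt_div_iff₀' hN).2 hlt)
  exact ⟨κ, hκ, (lt_div_iff₀' hN).1 hκc⟩

lemma eventually_add_mul_enthalpy_lt (hρ : IsEquationOfState ρ) (hN : 0 < N) (hS : 0 ≤ S)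
    (hc : 0 < c) (hκ : N * κ < c ^ 2 * enthalpy ρ N S) :
    ∀ᶠ q : ℝ × Space in 𝓝 (N, 0),
      q.1 * κ * (fourVel q.2 0 + 1) / (2 * c) + ‖q.2‖ * enthalpy ρ q.1 S <
        c * (enthalpy ρ q.1 S * fourVel q.2 0 + (enthalpy ρ q.1 S - enthalpy ρ N S)) := by
  have henth : ContinuousAt (fun q : ℝ × Space => enthalpy ρ q.1 S) (N, 0) :=
    ContinuousAt.comp (g := fun m => enthalpy ρ m S) (f := Prod.fst)
      (hρ.hasDerivAt_enthalpy hN hS).continuousAt continuousAt_fst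
  have hvel : ContinuousAt (fun q : ℝ × Space => fourVel q.2 0) (N, 0) := by
    simp only [fourVel_zero]
    fun_prop
  refine ContinuousAt.eventually_lt (by fun_prop) (by fun_prop) ?_
  have hγ : fourVel (0 : Space) 0 = 1 := by simp [fourVel_zero]
  simp only [hγ, norm_zero, zero_mul, add_zero, mul_one, sub_self]
  rw [div_lt_iff₀ (by positivity)]
  linarith

lemma eq_of_relativeCurrent_zero_eq_zero (hρ : IsEquationOfState ρ) (hN : 0 < N) (hS : 0 ≤ S)
    (hn : 0 < n) (hG0 : 0 ≤ relativeEnergy ρ N S n)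
    (hG : (enthalpy ρ n S - enthalpy ρ N S) ^ 2 ≤ 2 * κ * relativeEnergy ρ N S n)
    (hpos : 0 < enthalpy ρ n S * fourVel v 0 + (enthalpy ρ n S - enthalpy ρ N S))
    (h0 : relativeCurrent ρ N S n S v 0 = 0) : n = N ∧ v = 0 := by
  rw [relativeCurrent_zero] at h0
  have hkin : 0 ≤ n * (fourVel v 0 - 1) *
      (enthalpy ρ n S * fourVel v 0 + (enthalpy ρ n S - enthalpy ρ N S)) :=
    mul_nonneg (mul_nonneg hn.le (sub_nonneg.2 (one_le_fourVel_zero v))) hpos.le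
  obtain ⟨hkin0, hG1⟩ := (add_eq_zero_iff_of_nonneg hkin hG0).1 h0
  have henth : enthalpy ρ n S = enthalpy ρ N S := by
    rw [hG1, mul_zero] at hG
    exact sub_eq_zero.1 (pow_eq_zero_iff two_ne_zero |>.1 (le_antisymm hG (sq_nonneg _)))
  have hγ : fourVel v 0 = 1 := by
    simpa [hn.ne', hpos.ne', sub_eq_zero] using hkin0
  refine ⟨(hρ.strictMonoOn_enthalpy hS).injOn hn hN henth, ?_⟩
  have hv := fourVel_zero_sq v
  rw [hγ] at hv
  simpa using hv

lemma eventually_isCausal_relativeCurrent (hρ : IsEquationOfState ρ) (hN : 0 < N) (hS : 0 ≤ S)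
    (hc : soundSpeed ρ N S < c) :
    ∀ᶠ q : ℝ × Space in 𝓝 (N, 0), IsCausal c (relativeCurrent ρ N S q.1 S q.2) ∧
      (relativeCurrent ρ N S q.1 S q.2 0 = 0 → q.1 = N ∧ q.2 = 0) := by
  have hc0 : 0 < c := (hρ.soundSpeed_pos hN hS).trans hc
  obtain ⟨κ, hκ, hκc⟩ := hρ.exists_deriv_enthalpy_lt_and_mul_lt hN hS hc
  have hκ0 : 0 < κ := (hρ.deriv_enthalpy_pos hN hS).trans hκ
  filter_upwards [continuousAt_fst.eventually (hρ.eventually_sq_enthalpy_sub_le hN hS hκ),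
    continuousAt_fst.eventually (Ioi_mem_nhds hN),
    hρ.eventually_add_mul_enthalpy_lt hN hS hc0 hκc] with ⟨n, v⟩ hG hn hlt
  have hn : 0 < n := hn
  have hγ := one_le_fourVel_zero v
  have hh := hρ.enthalpy_pos hn hS
  have hG0 : 0 ≤ relativeEnergy ρ N S n :=
    nonneg_of_mul_nonneg_right ((sq_nonneg _).trans hG) (by positivity)
  have hpos : 0 < enthalpy ρ n S * fourVel v 0 + (enthalpy ρ n S - enthalpy ρ N S) :=
    pos_of_mul_pos_right (lt_of_le_of_lt (by positivity) hlt) hc0.le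
  refine ⟨?_, hρ.eq_of_relativeCurrent_zero_eq_zero hN hS hn hG0 hG hpos⟩
  rw [IsCausal, relativeCurrent_zero, spatial_relativeCurrent, norm_smul, Real.norm_eq_abs, abs_mul,
    abs_of_pos hn]
  exact mul_abs_mul_le_mul_relative_density hc0 hκ0 hn.le hh.le hγ (norm_nonneg v)
    (fourVel_zero_sq v) hG hlt.le

end IsEquationOfState

end RelativeCurrent

/-! ### Energy, momentum and the domain of dependence -/

section FieldEquations

variable {ρ : ℝ → ℝ → ℝ} {n₀ s₀ : Space → ℝ} {u₀ : Space → Space}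
  {n s : Spacetime → ℝ} {u : Spacetime → Space} {z : Spacetime}

namespace IsEquationOfState

lemma fderivWithin_rho_inl (hρ : IsEquationOfState ρ) {m σ : ℝ} (hm : 0 < m) (hσ : 0 ≤ σ) :
    fderivWithin ℝ (fun q : ℝ × ℝ => ρ q.1 q.2) (Ioi 0 ×ˢ Ici 0) (m, σ) (1, 0) =
      enthalpy ρ m σ := by
  have hL := (hρ.contDiffOn.differentiableOn two_ne_zero (m, σ) ⟨hm, hσ⟩).hasFDerivWithinAt
  have hline := (hL.comp (s := Ioi 0) (f := fun m : ℝ => (m, σ)) m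
    (hasFDerivAt_prodMk_left m σ).hasFDerivWithinAt fun m hm => ⟨hm, hσ⟩).hasFDerivAt
    (Ioi_mem_nhds hm)
  exact hline.hasDerivAt.unique (hρ.hasDerivAt_rho hm hσ)

lemma fderiv_rho_comp {E : Type*} [NormedAddCommGroup E] [NormedSpace ℝ E] {n s : E → ℝ} {z w : E}
    (hρ : IsEquationOfState ρ) (hn : DifferentiableAt ℝ n z) (hs : DifferentiableAt ℝ s z)
    (hn0 : 0 < n z) (hs0 : ∀ᶠ y in 𝓝 z, 0 ≤ s y) (hw : fderiv ℝ s z w = 0) :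
    fderiv ℝ (fun y => ρ (n y) (s y)) z w =
      enthalpy ρ (n z) (s z) * fderiv ℝ n z w := by
  have hL := (hρ.contDiffOn.differentiableOn two_ne_zero (n z, s z)
    ⟨hn0, hs0.self_of_nhds⟩).hasFDerivWithinAt
  have hcomp : HasFDerivAt (fun y => ρ (n y) (s y)) _ z :=
    (HasFDerivWithinAt.comp (s := {y | 0 < n y ∧ 0 ≤ s y}) (f := fun y => (n y, s y)) z hL
      (hn.hasFDerivAt.prodMk hs.hasFDerivAt).hasFDerivWithinAt fun y hy => hy).hasFDerivAt
      ((hn.continuousAt.eventually (Ioi_mem_nhds hn0)).and hs0)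
  rw [hcomp.fderiv, ContinuousLinearMap.comp_apply, ContinuousLinearMap.prod_apply, hw,
    ← hρ.fderivWithin_rho_inl hn0 hs0.self_of_nhds, mul_comm, ← smul_eq_mul, ← map_smul]
  simp

end IsEquationOfState

namespace IsGlobalC1Solution

lemma contDiffOn_fourVel (sol : IsGlobalC1Solution ρ n₀ s₀ u₀ n s u) (ν : Fin 4) :
    ContDiffOn ℝ 1 (fun y => fourVel (u y) ν) Future := by
  refine Fin.cases ?_ (fun i => ?_) ν
  · simp only [fourVel_zero]
    exact (contDiffOn_const.add (sol.contDiff_u.norm_sq ℝ)).sqrt fun z _ => by positivity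
  · simp only [fourVel_succ]
    exact contDiffOn_euclidean.1 sol.contDiff_u i

lemma contDiffOn_energyTensor (sol : IsGlobalC1Solution ρ n₀ s₀ u₀ n s u) (μ ν : Fin 4) :
    ContDiffOn ℝ 1 (fun y => energyTensor ρ (n y) (s y) (u y) μ ν) Future :=
  (((sol.contDiff_rho.add sol.contDiff_pressure).mul (sol.contDiffOn_fourVel μ)).mul
    (sol.contDiffOn_fourVel ν)).add (sol.contDiff_pressure.mul contDiffOn_const)

lemma contDiffOn_relativeCurrent (sol : IsGlobalC1Solution ρ n₀ s₀ u₀ n s u) (N S : ℝ)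
    (ν : Fin 4) :
    ContDiffOn ℝ 1 (fun y => relativeCurrent ρ N S (n y) (s y) (u y) ν) Future :=
  ((sol.contDiffOn_energyTensor 0 ν).sub (contDiffOn_const.mul
    (sol.contDiff_n.mul (sol.contDiffOn_fourVel ν)))).sub contDiffOn_const

lemma fderiv_entropy_fourVel (sol : IsGlobalC1Solution ρ n₀ s₀ u₀ n s u) (hz : 0 < z.1) :
    fderiv ℝ s z (fourVel (u z) 0, u z) = 0 :=
  (sum_mul_partialD (fourVel (u z)) s z).symm.trans (sol.adiabatic z hz)

lemma fderiv_rho_eq_zero_of_vacuum (sol : IsGlobalC1Solution ρ n₀ s₀ u₀ n s u)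
    (hρ : IsEquationOfState ρ) (hz : 0 < z.1) (hn : n z = 0) :
    fderiv ℝ (fun y => ρ (n y) (s y)) z = 0 := by
  have hmin : IsLocalMin (fun y => ρ (n y) (s y)) z := by
    filter_upwards [future_mem_nhds hz] with y hy
    rw [hn, hρ.rho_vacuum (sol.s_nonneg z hz.le)]
    exact hρ.rho_nonneg _ _ (sol.n_nonneg y hy.1) (sol.s_nonneg y hy.1)
  exact hmin.fderiv_eq_zero

lemma energy_equation (sol : IsGlobalC1Solution ρ n₀ s₀ u₀ n s u) (hρ : IsEquationOfState ρ)
    (hz : 0 < z.1) :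
    ∑ ν, fourVel (u z) ν * partialD ν (fun y => ρ (n y) (s y)) z +
      (ρ (n z) (s z) + pressure ρ (n z) (s z)) * divergence (fun ν y => fourVel (u y) ν) z = 0 := by
  have hdn := differentiableAt_of_contDiffOn_future sol.contDiff_n hz
  have hcont : fderiv ℝ n z (fourVel (u z) 0, u z) +
      n z * divergence (fun ν y => fourVel (u y) ν) z = 0 := by
    have h := divergence_mul hdn fun ν =>
      differentiableAt_of_contDiffOn_future (sol.contDiffOn_fourVel ν) hz
    rw [sum_mul_partialD (fourVel (u z))] at h
    exact h.symm.trans (sol.continuity z hz)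
  rw [sum_mul_partialD (fourVel (u z)), rho_add_pressure]
  rcases (sol.n_nonneg z hz.le).eq_or_lt with hn | hn
  · simp [sol.fderiv_rho_eq_zero_of_vacuum hρ hz hn.symm, ← hn]
  · have hs0 : ∀ᶠ y in 𝓝 z, 0 ≤ s y :=
      mem_of_superset (future_mem_nhds hz) fun y hy => sol.s_nonneg y hy.1
    have hstream := hρ.fderiv_rho_comp hdn
      (differentiableAt_of_contDiffOn_future sol.contDiff_s hz) hn hs0
      (sol.fderiv_entropy_fourVel hz)
    have hstream' : fderiv ℝ (fun y => ρ (n y) (s y)) z (fourVel (u z) 0,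
        WithLp.toLp 2 (Fin.tail (fourVel (u z)))) = _ := hstream
    rw [hstream']
    linear_combination enthalpy ρ (n z) (s z) * hcont

lemma divergence_energyTensor_eq_zero (sol : IsGlobalC1Solution ρ n₀ s₀ u₀ n s u)
    (hρ : IsEquationOfState ρ) (hz : 0 < z.1) (μ : Fin 4) :
    divergence (fun ν y => energyTensor ρ (n y) (s y) (u y) μ ν) z = 0 := by
  have hdρ := differentiableAt_of_contDiffOn_future sol.contDiff_rho hz
  have hdp := differentiableAt_of_contDiffOn_future sol.contDiff_pressure hz
  have hdu := fun ν => differentiableAt_of_contDiffOn_future (sol.contDiffOn_fourVel ν) hz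
  have hdH := hdρ.fun_add hdp
  have hdHu := hdH.fun_mul (hdu μ)
  have hadvect : ∀ ν, partialD ν (fun y => (ρ (n y) (s y) + pressure ρ (n y) (s y)) *
      fourVel (u y) μ) z =
      (partialD ν (fun y => ρ (n y) (s y)) z + partialD ν (fun y => pressure ρ (n y) (s y)) z) *
        fourVel (u z) μ +
      (ρ (n z) (s z) + pressure ρ (n z) (s z)) * partialD ν (fun y => fourVel (u y) μ) z :=
    fun ν => by rw [partialD_mul hdH (hdu μ), partialD_add hdρ hdp]
  have hT : divergence (fun ν y => energyTensor ρ (n y) (s y) (u y) μ ν) z = _ :=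
    divergence_add (fun ν => hdHu.fun_mul (hdu ν)) fun ν => hdp.fun_mul (differentiableAt_const _)
  rw [hT, divergence_mul hdHu hdu, divergence_mul hdp fun ν => differentiableAt_const _,
    divergence_const]
  have henergy := sol.energy_equation hρ hz
  have hmomentum := sol.momentum z hz μ
  simp only [hadvect, Fin.sum_univ_four] at henergy hmomentum ⊢
  linear_combination fourVel (u z) μ * henergy + hmomentum

lemma divergence_relativeCurrent_eq_zero (sol : IsGlobalC1Solution ρ n₀ s₀ u₀ n s u)
    (hρ : IsEquationOfState ρ) (N S : ℝ) (hz : 0 < z.1) :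
    divergence (fun ν y => relativeCurrent ρ N S (n y) (s y) (u y) ν) z = 0 := by
  have hdT := fun ν => differentiableAt_of_contDiffOn_future (sol.contDiffOn_energyTensor 0 ν) hz
  have hdnu := fun ν => (differentiableAt_of_contDiffOn_future sol.contDiff_n hz).fun_mul
    (differentiableAt_of_contDiffOn_future (sol.contDiffOn_fourVel ν) hz)
  have hdhnu := fun ν => (differentiableAt_const (enthalpy ρ N S)).fun_mul (hdnu ν)
  have hparticles : divergence (fun ν y => enthalpy ρ N S * (n y * fourVel (u y) ν)) z = 0 := by
    have hcont : divergence (fun ν y => n y * fourVel (u y) ν) z = 0 := sol.continuity z hz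
    rw [divergence_mul (differentiableAt_const _) hdnu, hcont]
    simp [partialD]
  simp only [relativeCurrent]
  rw [divergence_sub (fun ν => (hdT ν).fun_sub (hdhnu ν)) fun ν => differentiableAt_const _,
    divergence_sub hdT hdhnu, sol.divergence_energyTensor_eq_zero hρ hz, hparticles,
    divergence_const]
  simp

end IsGlobalC1Solution

end FieldEquations

section DomainOfDependence

variable {ρ : ℝ → ℝ → ℝ} {n₀ s₀ : Space → ℝ} {u₀ : Space → Space}
  {n s : Spacetime → ℝ} {u : Spacetime → Space} {N S c r τ t : ℝ} {x : Space}

lemma exists_pos_forall_Icc_forall_of_eventually {X : Type*} [TopologicalSpace X]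
    {U : Spacetime → X} (hU : ContinuousOn U Future) {K : Set Space} (hK : IsCompact K)
    (hτ : 0 ≤ τ) {P : X → Prop} {q : X} (hP : ∀ᶠ p in 𝓝 q, P p) (hq : ∀ x ∈ K, U (τ, x) = q) :
    ∃ δ > 0, ∀ t ∈ Icc τ (τ + δ), ∀ x ∈ K, P (U (t, x)) := by
  have htube := hK.eventually_forall_of_forall_eventually (x₀ := τ)
    (P := fun t x => 0 ≤ t → P (U (t, x))) fun x hx => by
      have h := (hU (τ, x) ⟨hτ, trivial⟩).tendsto
      rw [hq x hx] at h
      filter_upwards [eventually_nhdsWithin_iff.1 (h.eventually hP)] with z hz hz0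
        using hz ⟨hz0, trivial⟩
  obtain ⟨δ, hδ, hball⟩ := Metric.eventually_nhds_iff_ball.1 htube
  refine ⟨δ / 2, half_pos hδ, fun t ht x hx => hball t ?_ x hx (hτ.trans ht.1)⟩
  rw [Metric.mem_ball, Real.dist_eq, abs_lt]
  constructor <;> linarith [ht.1, ht.2]

/-- The state `(n, s, u)` of the fluid at the event `z`; it is quiet where it equals
`(N, S, 0)`. -/
def fluidState (n s : Spacetime → ℝ) (u : Spacetime → Space) (z : Spacetime) : ℝ × ℝ × Space :=
  (n z, s z, u z)

namespace IsGlobalC1Solution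

lemma continuousOn_fluidState (sol : IsGlobalC1Solution ρ n₀ s₀ u₀ n s u) :
    ContinuousOn (fluidState n s u) Future :=
  sol.contDiff_n.continuousOn.prodMk
    (sol.contDiff_s.continuousOn.prodMk sol.contDiff_u.continuousOn)

lemma le_entropy_tip (sol : IsGlobalC1Solution ρ n₀ s₀ u₀ n s u) (hτ : 0 ≤ τ) (hτt : τ ≤ t)
    (hc : ∀ z ∈ backwardCone c τ t x, ‖u z‖ ≤ c * fourVel (u z) 0)
    (hS : ∀ y, ‖y - x‖ ≤ c * (t - τ) → S ≤ s (τ, y)) : S ≤ s (t, x) :=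
  le_tip_of_fderiv_nonneg (fun z => (fourVel (u z) 0, u z)) hτt
    (sol.contDiff_s.continuousOn.mono fun _ hz => ⟨hτ.trans hz.1, trivial⟩)
    (fun _ _ hz => differentiableAt_of_contDiffOn_future sol.contDiff_s (hτ.trans_lt hz))
    (fun z _ => zero_lt_one.trans_le (one_le_fourVel_zero (u z))) hc
    (fun _ _ hz => (sol.fderiv_entropy_fourVel (hτ.trans_lt hz)).ge) hS

lemma entropy_tip_le (sol : IsGlobalC1Solution ρ n₀ s₀ u₀ n s u) (hτ : 0 ≤ τ) (hτt : τ ≤ t)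
    (hc : ∀ z ∈ backwardCone c τ t x, ‖u z‖ ≤ c * fourVel (u z) 0)
    (hS : ∀ y, ‖y - x‖ ≤ c * (t - τ) → s (τ, y) ≤ S) : s (t, x) ≤ S := by
  refine neg_le_neg_iff.1 (le_tip_of_fderiv_nonneg (f := fun z => -s z)
    (fun z => (fourVel (u z) 0, u z)) hτt
    (sol.contDiff_s.continuousOn.neg.mono fun _ hz => ⟨hτ.trans hz.1, trivial⟩)
    (fun _ _ hz => (differentiableAt_of_contDiffOn_future sol.contDiff_s (hτ.trans_lt hz)).fun_neg)
    (fun z _ => zero_lt_one.trans_le (one_le_fourVel_zero (u z))) hc (fun _ _ hz => ?_)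
    fun y hy => neg_le_neg (hS y hy))
  simp [fderiv_fun_neg, sol.fderiv_entropy_fourVel (hτ.trans_lt hz)]

lemma le_entropy (sol : IsGlobalC1Solution ρ n₀ s₀ u₀ n s u) (hS : ∀ x, S ≤ s₀ x) (ht : 0 ≤ t) :
    S ≤ s (t, x) :=
  sol.le_entropy_tip (c := 1) le_rfl ht
    (fun z _ => (norm_le_fourVel_zero (u z)).trans_eq (one_mul _).symm)
    fun y _ => (hS y).trans_eq (sol.init_s y).symm

lemma fluidState_eq_of_forall_isCausal (sol : IsGlobalC1Solution ρ n₀ s₀ u₀ n s u)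
    (hρ : IsEquationOfState ρ) (hc : 0 < c) (hτ : 0 ≤ τ)
    (hcone : ∀ z ∈ openCone c τ t x, ‖u z‖ ≤ c ∧
      IsCausal c (relativeCurrent ρ N S (n z) S (u z)) ∧
      (relativeCurrent ρ N S (n z) S (u z) 0 = 0 → n z = N ∧ u z = 0))
    (hbase : ∀ y, ‖y - x‖ < c * (t - τ) → fluidState n s u (τ, y) = (N, S, 0))
    {z : Spacetime} (hz : z ∈ openCone c τ t x) : fluidState n s u z = (N, S, 0) := by
  have hbase' := fun y hy => Prod.mk.inj (hbase y hy)
  have hbase_s : ∀ y, ‖y - x‖ < c * (t - τ) → s (τ, y) = S := fun y hy =>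
    (Prod.mk.inj (hbase' y hy).2).1
  have hentropy : ∀ z ∈ openCone c τ t x, s z = S := by
    rintro z ⟨⟨hτz, hzt⟩, hz⟩
    have hsub : ∀ w : Spacetime, ‖w.2 - z.2‖ ≤ c * (z.1 - w.1) → ‖w.2 - x‖ < c * (t - w.1) := by
      intro w hw
      linarith [norm_sub_le_norm_sub_add_norm_sub w.2 z.2 x]
    have hspeed : ∀ w ∈ backwardCone c τ z.1 z.2, ‖u w‖ ≤ c * fourVel (u w) 0 := fun w hw =>
      (hcone w ⟨⟨hw.1, hw.2.1.trans hzt⟩, hsub w hw.2.2⟩).1.trans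
        (le_mul_of_one_le_right hc.le (one_le_fourVel_zero (u w)))
    exact le_antisymm
      (sol.entropy_tip_le hτ hτz hspeed fun y hy => (hbase_s y (hsub (τ, y) hy)).le)
      (sol.le_entropy_tip hτ hτz hspeed fun y hy => (hbase_s y (hsub (τ, y) hy)).ge)
  have hzero := eq_zero_of_isCausal_of_divergence_eq_zero
    (J := fun ν z => relativeCurrent ρ N S (n z) (s z) (u z) ν) hc hτ
    (sol.contDiffOn_relativeCurrent N S)
    (fun z hz => sol.divergence_relativeCurrent_eq_zero hρ N S hz)
    (fun z hz => by simpa only [hentropy z hz] using (hcone z hz).2.1)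
    (fun y hy => by
      have hy := hbase' y hy.2
      simp only [hy.1, (Prod.mk.inj hy.2).1, (Prod.mk.inj hy.2).2, relativeCurrent_self])
    hz
  rw [hentropy z hz] at hzero
  obtain ⟨hn, hu⟩ := (hcone z hz).2.2 hzero
  simp only [fluidState, hn, hentropy z hz, hu]

lemma exists_pos_forall_Icc_isCausal (sol : IsGlobalC1Solution ρ n₀ s₀ u₀ n s u)
    (hρ : IsEquationOfState ρ) (hN : 0 < N) (hS : 0 ≤ S) (hc : soundSpeed ρ N S < c) (hτ : 0 ≤ τ)
    (hbase : ∀ y ∈ Metric.closedBall x r, fluidState n s u (τ, y) = (N, S, 0)) :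
    ∃ δ > 0, ∀ t ∈ Icc τ (τ + δ), ∀ y ∈ Metric.closedBall x r, ‖u (t, y)‖ ≤ c ∧
      IsCausal c (relativeCurrent ρ N S (n (t, y)) S (u (t, y))) ∧
      (relativeCurrent ρ N S (n (t, y)) S (u (t, y)) 0 = 0 → n (t, y) = N ∧ u (t, y) = 0) := by
  have hc0 : 0 < c := (hρ.soundSpeed_pos hN hS).trans hc
  have hcausal : ∀ᶠ q : ℝ × ℝ × Space in 𝓝 (N, S, 0), ‖q.2.2‖ ≤ c ∧
      IsCausal c (relativeCurrent ρ N S q.1 S q.2.2) ∧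
      (relativeCurrent ρ N S q.1 S q.2.2 0 = 0 → q.1 = N ∧ q.2.2 = 0) := by
    have hproj : Continuous fun q : ℝ × ℝ × Space => (q.1, q.2.2) := by fun_prop
    have hnorm : Continuous fun q : ℝ × ℝ × Space => ‖q.2.2‖ := by fun_prop
    exact ((hnorm.tendsto' (N, S, 0) 0 norm_zero).eventually_le_const hc0).and
      ((hproj.tendsto' (N, S, 0) (N, 0) rfl).eventually
        (hρ.eventually_isCausal_relativeCurrent hN hS hc))
  exact exists_pos_forall_Icc_forall_of_eventually
    sol.continuousOn_fluidState (isCompact_closedBall x r) hτ hcausal hbase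

lemma exists_pos_forall_fluidState_eq (sol : IsGlobalC1Solution ρ n₀ s₀ u₀ n s u)
    (hρ : IsEquationOfState ρ) (hN : 0 < N) (hS : 0 ≤ S) (hc : soundSpeed ρ N S < c)
    (hτ : 0 ≤ τ) (hr : 0 < r)
    (hbase : ∀ y ∈ Metric.closedBall x r, fluidState n s u (τ, y) = (N, S, 0)) :
    ∃ δ > 0, ∀ t ∈ Ico τ (τ + δ), ∀ y ∈ Metric.closedBall x (r - c * (t - τ)),
      fluidState n s u (t, y) = (N, S, 0) := by
  have hc0 : 0 < c := (hρ.soundSpeed_pos hN hS).trans hc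
  obtain ⟨ε, hε, hcone⟩ := sol.exists_pos_forall_Icc_isCausal hρ hN hS hc hτ hbase
  refine ⟨min ε (r / c), lt_min hε (div_pos hr hc0), fun t ht => ?_⟩
  have htε : t < τ + ε := ht.2.trans_le (by gcongr; exact min_le_left _ _)
  have hradius : 0 < r - c * (t - τ) := by
    have h : t - τ < r / c := by linarith [ht.2, min_le_right ε (r / c)]
    linarith [(lt_div_iff₀' hc0).1 h]
  have hopen : EqOn (fun y => fluidState n s u (t, y)) (fun _ => (N, S, 0))
      (Metric.ball x (r - c * (t - τ))) := by
    intro y hy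
    rw [mem_ball_iff_norm] at hy
    -- A cone whose tip lies slightly above `(t, y)` still has its base in the ball of radius `r`.
    obtain ⟨t', ht', ht'ε, hsmall⟩ : ∃ t', t < t' ∧ t' < τ + ε ∧ ‖y - x‖ < r - c * (t' - τ) := by
      have hcont : Continuous fun t' => r - c * (t' - τ) := by fun_prop
      have hnear : ∀ᶠ t' in 𝓝 t, t' < τ + ε ∧ ‖y - x‖ < r - c * (t' - τ) :=
        (eventually_lt_nhds htε).and (hcont.continuousAt.eventually_const_lt hy)
      obtain ⟨t', h, htt'⟩ :=
        ((hnear.filter_mono nhdsWithin_le_nhds).and (self_mem_nhdsWithin (s := Ioi t))).exists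
      exact ⟨t', htt', h⟩
    have hball : ∀ w : Spacetime, τ ≤ w.1 → ‖w.2 - y‖ < c * (t' - w.1) →
        w.2 ∈ Metric.closedBall x r := fun w hτw hw => by
      rw [mem_closedBall_iff_norm]
      linarith [norm_sub_le_norm_sub_add_norm_sub w.2 y x, mul_le_mul_of_nonneg_left hτw hc0.le]
    refine sol.fluidState_eq_of_forall_isCausal (t := t') (x := y) hρ hc0 hτ
      (fun z hz => hcone z.1 ⟨hz.1.1, hz.1.2.trans ht'ε.le⟩ z.2 (hball z hz.1.1 hz.2))
      (fun w hw => hbase w (hball (τ, w) le_rfl hw)) ⟨⟨ht.1, ht'.le⟩, ?_⟩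
    simpa using mul_pos hc0 (sub_pos.2 ht')
  have hclosure := hopen.closure
    (continuous_slice sol.continuousOn_fluidState (hτ.trans ht.1)) continuous_const
  rwa [closure_ball x hradius.ne'] at hclosure

lemma fluidState_eq_of_forall_closedBall (sol : IsGlobalC1Solution ρ n₀ s₀ u₀ n s u)
    (hρ : IsEquationOfState ρ) (hN : 0 < N) (hS : 0 ≤ S) (hc : soundSpeed ρ N S < c)
    (hr : c * t < r) (ht : 0 ≤ t)
    (hbase : ∀ y ∈ Metric.closedBall x r, fluidState n s u (0, y) = (N, S, 0)) :
    fluidState n s u (t, x) = (N, S, 0) := by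
  have hc0 : 0 < c := (hρ.soundSpeed_pos hN hS).trans hc
  have hradius : ∀ τ ≤ t, 0 < r - c * τ := fun τ hτ => by
    linarith [mul_le_mul_of_nonneg_left hτ hc0.le]
  set A : Set ℝ := {τ | ∀ w ∈ Metric.closedBall (0 : Space) 1,
    fluidState n s u (τ, x + (r - c * τ) • w) = (N, S, 0)}
  have hA : ∀ τ ≤ t, τ ∈ A ↔
      ∀ y ∈ Metric.closedBall x (r - c * τ), fluidState n s u (τ, y) = (N, S, 0) := by
    intro τ hτ
    rw [← affinity_unitClosedBall (hradius τ hτ).le]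
    simp [A, mem_vadd_set, mem_smul_set]
  have hclosed : IsClosed (A ∩ Icc 0 t) := by
    have hinter : A ∩ Icc 0 t = ⋂ w ∈ Metric.closedBall (0 : Space) 1, Icc 0 t ∩
        (fun τ => fluidState n s u (τ, x + (r - c * τ) • w)) ⁻¹' {(N, S, 0)} := by
      ext τ
      simp only [A, mem_inter_iff, mem_iInter]
      exact ⟨fun h w hw => ⟨h.2, h.1 w hw⟩,
        fun h => ⟨fun w hw => (h w hw).2, (h 0 (by simp)).1⟩⟩
    rw [hinter]
    exact isClosed_biInter fun w _ => ContinuousOn.preimage_isClosed_of_isClosed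
      (sol.continuousOn_fluidState.comp (by fun_prop) fun τ hτ => ⟨hτ.1, trivial⟩)
      isClosed_Icc isClosed_singleton
  have h0 : (0 : ℝ) ∈ A := (hA 0 ht).2 (by simpa using hbase)
  have htA : t ∈ A := by
    refine hclosed.Icc_subset_of_forall_exists_gt h0 ?_ ⟨ht, le_rfl⟩
    rintro τ ⟨hτA, hτ0, hτt⟩ b (hb : τ < b)
    obtain ⟨δ, hδ, hquiet⟩ := sol.exists_pos_forall_fluidState_eq hρ hN hS hc hτ0
      (hradius τ hτt.le) ((hA τ hτt.le).1 hτA)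
    obtain ⟨t', hτt', ht'⟩ := exists_between
      (lt_min (lt_min hb hτt) (lt_add_of_pos_right τ hδ))
    simp only [lt_min_iff] at ht'
    refine ⟨t', (hA t' ht'.1.2.le).2 fun y hy => hquiet t' ⟨hτt'.le, ht'.2⟩ y ?_, hτt', ht'.1.1.le⟩
    rwa [show r - c * τ - c * (t' - τ) = r - c * t' by ring]
  exact (hA t le_rfl).1 htA x (Metric.mem_closedBall_self (hradius t le_rfl).le)

lemma fluidState_eq_of_add_lt_norm (sol : IsGlobalC1Solution ρ n₀ s₀ u₀ n s u)
    (hρ : IsEquationOfState ρ) (hN : 0 < N) (hS : 0 ≤ S) {R : ℝ}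
    (hquiet : ∀ x, R < ‖x‖ → n₀ x = N ∧ s₀ x = S ∧ u₀ x = 0) (ht : 0 ≤ t)
    (hx : R + soundSpeed ρ N S * t < ‖x‖) : fluidState n s u (t, x) = (N, S, 0) := by
  obtain ⟨c, hc, hcx⟩ : ∃ c, soundSpeed ρ N S < c ∧ R + c * t < ‖x‖ := by
    have hcont : Continuous fun c : ℝ => R + c * t := by fun_prop
    obtain ⟨c, hcx, hc⟩ := (((hcont.continuousAt.eventually_lt_const hx).filter_mono
      nhdsWithin_le_nhds).and (self_mem_nhdsWithin (s := Ioi (soundSpeed ρ N S)))).exists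
    exact ⟨c, hc, hcx⟩
  obtain ⟨r, hr, hrx⟩ := exists_between (lt_sub_iff_add_lt'.2 hcx)
  refine sol.fluidState_eq_of_forall_closedBall hρ hN hS hc hr ht fun y hy => ?_
  have hy : R < ‖y‖ := by
    rw [mem_closedBall_iff_norm, norm_sub_rev] at hy
    linarith [norm_sub_norm_le x y]
  obtain ⟨hn, hs, hu⟩ := hquiet y hy
  simp only [fluidState, sol.init_n, sol.init_s, sol.init_u, hn, hs, hu]

end IsGlobalC1Solution

end DomainOfDependence

/-! ### The virial argument -/

section IntegralIdentities

variable {ρ : ℝ → ℝ → ℝ} {N S R T t : ℝ} {z : Spacetime}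

lemma energyTensor_comm (ρ : ℝ → ℝ → ℝ) (n s : ℝ) (v : Space) (μ ν : Fin 4) :
    energyTensor ρ n s v μ ν = energyTensor ρ n s v ν μ := by
  simp only [energyTensor, minkowski]
  rcases eq_or_ne μ ν with rfl | h
  · rfl
  · rw [if_neg h, if_neg h.symm]
    ring

lemma energyTensor_zero_zero (ρ : ℝ → ℝ → ℝ) (n s : ℝ) (v : Space) :
    energyTensor ρ n s v 0 0 = ρ n s + (ρ n s + pressure ρ n s) * ‖v‖ ^ 2 := by
  simp only [energyTensor, minkowski, if_true]
  linear_combination (ρ n s + pressure ρ n s) * fourVel_zero_sq v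

lemma energyTensor_zero_succ (ρ : ℝ → ℝ → ℝ) (n s : ℝ) (v : Space) (i : Fin 3) :
    energyTensor ρ n s v 0 i.succ = (ρ n s + pressure ρ n s) * fourVel v 0 * v i := by
  simp [energyTensor, minkowski, (Fin.succ_ne_zero i).symm, fourVel_succ]

lemma energyTensor_rest_succ (ρ : ℝ → ℝ → ℝ) (n s : ℝ) (i : Fin 3) (ν : Fin 4) :
    energyTensor ρ n s 0 i.succ ν = pressure ρ n s * minkowski i.succ ν := by
  simp [energyTensor, fourVel_succ]

lemma sum_energyTensor_succ_sub (ρ : ℝ → ℝ → ℝ) (n s : ℝ) (v : Space) (P : ℝ) :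
    ∑ i : Fin 3, (energyTensor ρ n s v i.succ i.succ - P * minkowski i.succ i.succ) =
      (ρ n s + pressure ρ n s) * ‖v‖ ^ 2 + 3 * (pressure ρ n s - P) := by
  rw [EuclideanSpace.real_norm_sq_eq]
  simp only [energyTensor, minkowski, fourVel_succ, if_true, Fin.succ_ne_zero, if_false,
    Fin.sum_univ_three]
  ring

lemma divergence_sum_coord_mul {G : Fin 3 → Fin 4 → Spacetime → ℝ}
    (hG : ∀ i ν, DifferentiableAt ℝ (G i ν) z) :
    divergence (fun ν y => ∑ i, y.2 i * G i ν y) z =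
      ∑ i, G i i.succ z + ∑ i, z.2 i * divergence (G i) z := by
  let coord : Fin 3 → Spacetime →L[ℝ] ℝ := fun i =>
    (EuclideanSpace.proj i).comp (ContinuousLinearMap.snd ℝ ℝ Space)
  have hcoord : ∀ i, DifferentiableAt ℝ (fun y : Spacetime => y.2 i) z := fun i =>
    (coord i).differentiableAt
  have hfderiv : ∀ i, fderiv ℝ (fun y : Spacetime => y.2 i) z = coord i := fun i =>
    (coord i).hasFDerivAt.fderiv
  calc divergence (fun ν y => ∑ i, y.2 i * G i ν y) z
      = ∑ i, divergence (fun ν y => y.2 i * G i ν y) z := by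
        simp only [divergence, partialD, fderiv_fun_sum fun i _ => (hcoord i).fun_mul (hG i _),
          FunLike.coe_sum, Finset.sum_apply]
        exact Finset.sum_comm
    _ = ∑ i, (G i i.succ z + z.2 i * divergence (G i) z) := by
        refine Finset.sum_congr rfl fun i _ => ?_
        rw [divergence_mul (hcoord i) (hG i), sum_mul_partialD fun ν => G i ν z, hfderiv]
        rfl
    _ = _ := Finset.sum_add_distrib

/-- The virial `∫ ((ρ + p) |u|² + 3 (p - p̄)) dx`, the rate of change of the radial momentum. -/
def virial (ρ : ℝ → ℝ → ℝ) (nbar sbar : ℝ) (n s : Space → ℝ) (u : Space → Space) : ℝ :=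
  ∫ x, ((ρ (n x) (s x) + pressure ρ (n x) (s x)) * ‖u x‖ ^ 2 +
    3 * (pressure ρ (n x) (s x) - pressure ρ nbar sbar))

/-- The moments `x_i (T^{iν} - p̄ g^{iν})`, summed over `i`: a current whose density is the density
of radial momentum. -/
def momentCurrent (ρ : ℝ → ℝ → ℝ) (N S : ℝ) (n s : Spacetime → ℝ) (u : Spacetime → Space)
    (ν : Fin 4) (z : Spacetime) : ℝ :=
  ∑ i : Fin 3, z.2 i *
    (energyTensor ρ (n z) (s z) (u z) i.succ ν - pressure ρ N S * minkowski i.succ ν)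

lemma integral_momentCurrent_zero (n s : Spacetime → ℝ) (u : Spacetime → Space) (t : ℝ) :
    ∫ x, momentCurrent ρ N S n s u 0 (t, x) =
      radialMomentum ρ (n.curry t) (s.curry t) (u.curry t) := by
  simp [radialMomentum, momentCurrent, minkowski, energyTensor_comm, Function.curry]

namespace IsGlobalC1Solution

variable {n₀ s₀ : Space → ℝ} {u₀ : Space → Space} {n s : Spacetime → ℝ} {u : Spacetime → Space}

lemma vanishesOff (sol : IsGlobalC1Solution ρ n₀ s₀ u₀ n s u) (hρ : IsEquationOfState ρ)
    (hN : 0 < N) (hS : 0 ≤ S) (hquiet : ∀ x, R < ‖x‖ → n₀ x = N ∧ s₀ x = S ∧ u₀ x = 0)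
    {f : Spacetime → ℝ} (hf : ∀ z, fluidState n s u z = (N, S, 0) → f z = 0) :
    VanishesOff (Metric.closedBall 0 (R + soundSpeed ρ N S * T)) (Icc 0 T) f := by
  intro t ht x hx
  refine hf _ (sol.fluidState_eq_of_add_lt_norm hρ hN hS hquiet ht.1 ?_)
  rw [mem_closedBall_zero_iff, not_le] at hx
  linarith [mul_le_mul_of_nonneg_left ht.2 (hρ.soundSpeed_pos hN hS).le]

lemma perturbationEnergy_eq (sol : IsGlobalC1Solution ρ n₀ s₀ u₀ n s u)
    (hρ : IsEquationOfState ρ) (hN : 0 < N) (hS : 0 ≤ S)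
    (hquiet : ∀ x, R < ‖x‖ → n₀ x = N ∧ s₀ x = S ∧ u₀ x = 0) (ht : 0 ≤ t) :
    perturbationEnergy ρ N S (n.curry t) (s.curry t) (u.curry t) =
      perturbationEnergy ρ N S n₀ s₀ u₀ := by
  have hvanish : ∀ ν, VanishesOff (Metric.closedBall 0 (R + soundSpeed ρ N S * t)) (Icc 0 t)
      fun z => energyTensor ρ (n z) (s z) (u z) 0 ν - energyTensor ρ N S 0 0 ν := fun ν =>
    sol.vanishesOff hρ hN hS hquiet fun z hz => by
      simp only [fluidState, Prod.mk.injEq] at hz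
      simp [hz]
  have hconserved := integral_slice_eq_of_divergence_eq_zero hvanish (isCompact_closedBall _ _)
    (fun ν => (sol.contDiffOn_energyTensor 0 ν).sub contDiffOn_const) (fun z hz => by
      rw [divergence_sub (fun ν => differentiableAt_of_contDiffOn_future
        (sol.contDiffOn_energyTensor 0 ν) hz) fun ν => differentiableAt_const _, divergence_const,
        sol.divergence_energyTensor_eq_zero hρ hz, sub_zero]) ht
  simpa only [perturbationEnergy, Function.curry, sol.init_n, sol.init_s, sol.init_u]
    using hconserved

lemma contDiffOn_momentCurrent (sol : IsGlobalC1Solution ρ n₀ s₀ u₀ n s u) (ν : Fin 4) :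
    ContDiffOn ℝ 1 (momentCurrent ρ N S n s u ν) Future :=
  ContDiffOn.sum fun i _ => (by fun_prop : ContDiff ℝ 1 fun z : Spacetime => z.2 i).contDiffOn.mul
    ((sol.contDiffOn_energyTensor i.succ ν).sub contDiffOn_const)

lemma vanishesOff_momentCurrent (sol : IsGlobalC1Solution ρ n₀ s₀ u₀ n s u)
    (hρ : IsEquationOfState ρ) (hN : 0 < N) (hS : 0 ≤ S)
    (hquiet : ∀ x, R < ‖x‖ → n₀ x = N ∧ s₀ x = S ∧ u₀ x = 0) (ν : Fin 4) :
    VanishesOff (Metric.closedBall 0 (R + soundSpeed ρ N S * T)) (Icc 0 T)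
      (momentCurrent ρ N S n s u ν) :=
  sol.vanishesOff hρ hN hS hquiet fun z hz => by
    simp only [fluidState, Prod.mk.injEq] at hz
    simp [momentCurrent, hz, energyTensor_rest_succ]

lemma divergence_momentCurrent (sol : IsGlobalC1Solution ρ n₀ s₀ u₀ n s u)
    (hρ : IsEquationOfState ρ) (hz : 0 < z.1) :
    divergence (momentCurrent ρ N S n s u) z =
      (ρ (n z) (s z) + pressure ρ (n z) (s z)) * ‖u z‖ ^ 2 +
        3 * (pressure ρ (n z) (s z) - pressure ρ N S) := by
  have hdT := fun (i : Fin 3) ν =>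
    differentiableAt_of_contDiffOn_future (sol.contDiffOn_energyTensor i.succ ν) hz
  have hconserved : ∀ i : Fin 3, divergence (fun ν y =>
      energyTensor ρ (n y) (s y) (u y) i.succ ν - pressure ρ N S * minkowski i.succ ν) z = 0 :=
    fun i => by
      rw [divergence_sub (hdT i) fun ν => differentiableAt_const _, divergence_const,
        sol.divergence_energyTensor_eq_zero hρ hz, sub_zero]
  rw [← sum_energyTensor_succ_sub]
  refine (divergence_sum_coord_mul fun i ν => (hdT i ν).fun_sub (differentiableAt_const _)).trans ?_
  simp only [hconserved, mul_zero, Finset.sum_const_zero, add_zero]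

lemma continuousOn_radialMomentum (sol : IsGlobalC1Solution ρ n₀ s₀ u₀ n s u)
    (hρ : IsEquationOfState ρ) (hN : 0 < N) (hS : 0 ≤ S)
    (hquiet : ∀ x, R < ‖x‖ → n₀ x = N ∧ s₀ x = S ∧ u₀ x = 0) :
    ContinuousOn (fun t => radialMomentum ρ (n.curry t) (s.curry t) (u.curry t)) (Ici 0) := by
  simp only [← integral_momentCurrent_zero (N := N) (S := S)]
  intro t ht
  have ht0 : 0 ≤ t := ht
  refine ((sol.vanishesOff_momentCurrent hρ hN hS hquiet 0).continuousOn_integral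
    (isCompact_closedBall _ _) (sol.contDiffOn_momentCurrent 0).continuousOn Icc_subset_Ici_self
    t ⟨ht0, (lt_add_one t).le⟩).mono_of_mem_nhdsWithin ?_
  exact inter_mem_nhdsWithin _ (Iic_mem_nhds (lt_add_one t))

lemma hasDerivAt_radialMomentum (sol : IsGlobalC1Solution ρ n₀ s₀ u₀ n s u)
    (hρ : IsEquationOfState ρ) (hN : 0 < N) (hS : 0 ≤ S)
    (hquiet : ∀ x, R < ‖x‖ → n₀ x = N ∧ s₀ x = S ∧ u₀ x = 0) (ht : 0 < t) :
    HasDerivAt (fun t => radialMomentum ρ (n.curry t) (s.curry t) (u.curry t))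
      (virial ρ N S (n.curry t) (s.curry t) (u.curry t)) t := by
  have h := hasDerivAt_integral_divergence (sol.vanishesOff_momentCurrent hρ hN hS hquiet)
    (isCompact_closedBall _ _) sol.contDiffOn_momentCurrent ht (Icc_mem_nhds ht (lt_add_one t))
  simp only [integral_momentCurrent_zero, sol.divergence_momentCurrent hρ (z := (t, _)) ht] at h
  exact h

end IsGlobalC1Solution

end IntegralIdentities

section VirialInequality

variable {ρ : ℝ → ℝ → ℝ} {N S r : ℝ} {n s : Space → ℝ} {u : Space → Space}

/-- The integral `∫ (ρ + p) |u|² dx`, which controls the growth of the radial momentum. -/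
def kineticIntegral (ρ : ℝ → ℝ → ℝ) (n s : Space → ℝ) (u : Space → Space) : ℝ :=
  ∫ x, (ρ (n x) (s x) + pressure ρ (n x) (s x)) * ‖u x‖ ^ 2

/-- A state of the fluid at a fixed time which is quiet outside the ball of radius `r`. Continuity
is required of the energy density and the pressure themselves: in vacuum it does not follow from
that of `n` and `s`. -/
structure IsQuietOutside (ρ : ℝ → ℝ → ℝ) (N S r : ℝ) (n s : Space → ℝ) (u : Space → Space) :
    Prop where
  n_nonneg : ∀ x, 0 ≤ n x
  s_nonneg : ∀ x, 0 ≤ s x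
  continuous_rho : Continuous fun x => ρ (n x) (s x)
  continuous_pressure : Continuous fun x => pressure ρ (n x) (s x)
  continuous_u : Continuous u
  quiet : ∀ x, r < ‖x‖ → n x = N ∧ s x = S ∧ u x = 0

lemma integrable_of_forall_lt_norm {f : Space → ℝ} (hf : Continuous f)
    (h : ∀ x, r < ‖x‖ → f x = 0) : Integrable f :=
  hf.integrable_of_hasCompactSupport (HasCompactSupport.intro (isCompact_closedBall 0 r)
    fun x hx => h x (by simpa using hx))

lemma integrable_indicator_closedBall (x : Space) (r a : ℝ) :
    Integrable ((Metric.closedBall x r).indicator fun _ => a) :=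
  (integrable_indicator_iff measurableSet_closedBall).2
    (integrableOn_const (isCompact_closedBall _ _).measure_lt_top.ne)

lemma integral_indicator_closedBall (x : Space) (hr : 0 ≤ r) (a : ℝ) :
    ∫ y, (Metric.closedBall x r).indicator (fun _ => a) y = 4 * Real.pi / 3 * a * r ^ 3 := by
  rw [integral_indicator measurableSet_closedBall, setIntegral_const, Measure.real,
    EuclideanSpace.volume_closedBall_fin_three, ENNReal.toReal_mul, ENNReal.toReal_pow,
    ENNReal.toReal_ofReal hr, ENNReal.toReal_ofReal (by positivity), smul_eq_mul]
  ring

namespace IsEquationOfState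

lemma rho_add_pressure_nonneg (hρ : IsEquationOfState ρ) {m σ : ℝ} (hm : 0 ≤ m) (hσ : 0 ≤ σ) :
    0 ≤ ρ m σ + pressure ρ m σ :=
  add_nonneg (hρ.rho_nonneg m σ hm hσ) (hρ.pressure_nonneg m σ hm hσ)

lemma energyTensor_zero_zero_nonneg (hρ : IsEquationOfState ρ) {m σ : ℝ} (hm : 0 ≤ m)
    (hσ : 0 ≤ σ) (v : Space) : 0 ≤ energyTensor ρ m σ v 0 0 := by
  rw [energyTensor_zero_zero]
  exact add_nonneg (hρ.rho_nonneg m σ hm hσ)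
    (mul_nonneg (hρ.rho_add_pressure_nonneg hm hσ) (sq_nonneg _))

lemma sq_sum_mul_energyTensor_le (hρ : IsEquationOfState ρ) {m σ : ℝ} (hm : 0 ≤ m) (hσ : 0 ≤ σ)
    (v x : Space) :
    (∑ i : Fin 3, x i * energyTensor ρ m σ v 0 i.succ) ^ 2 ≤
      2 * ‖x‖ ^ 2 * energyTensor ρ m σ v 0 0 * ((ρ m σ + pressure ρ m σ) * ‖v‖ ^ 2) := by
  have hH := hρ.rho_add_pressure_nonneg hm hσ
  have hinner : ∑ i : Fin 3, x i * energyTensor ρ m σ v 0 i.succ =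
      (ρ m σ + pressure ρ m σ) * fourVel v 0 * inner ℝ x v := by
    simp only [energyTensor_zero_succ, PiLp.inner_apply, Finset.mul_sum]
    exact Finset.sum_congr rfl fun i _ => by simp; ring
  have hcauchy : inner ℝ x v ^ 2 ≤ ‖x‖ ^ 2 * ‖v‖ ^ 2 := by
    rw [← mul_pow, sq_le_sq, abs_of_nonneg (by positivity : 0 ≤ ‖x‖ * ‖v‖)]
    exact abs_real_inner_le_norm x v
  have hdensity : (ρ m σ + pressure ρ m σ) * fourVel v 0 ^ 2 ≤ 2 * energyTensor ρ m σ v 0 0 := by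
    rw [fourVel_zero_sq, energyTensor_zero_zero]
    linarith [hρ.pressure_le_rho m σ hm hσ, mul_nonneg hH (sq_nonneg ‖v‖)]
  calc (∑ i : Fin 3, x i * energyTensor ρ m σ v 0 i.succ) ^ 2
      = (ρ m σ + pressure ρ m σ) * ((ρ m σ + pressure ρ m σ) * fourVel v 0 ^ 2) *
          inner ℝ x v ^ 2 := by rw [hinner]; ring
    _ ≤ (ρ m σ + pressure ρ m σ) * (2 * energyTensor ρ m σ v 0 0) * (‖x‖ ^ 2 * ‖v‖ ^ 2) := by
        have hT := hρ.energyTensor_zero_zero_nonneg hm hσ v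
        gcongr
    _ = _ := by ring

end IsEquationOfState

namespace IsQuietOutside

lemma continuous_energyTensor_zero_zero (hq : IsQuietOutside ρ N S r n s u) :
    Continuous fun x => energyTensor ρ (n x) (s x) (u x) 0 0 := by
  simp only [energyTensor_zero_zero]
  exact hq.continuous_rho.add
    ((hq.continuous_rho.add hq.continuous_pressure).mul (hq.continuous_u.norm.pow 2))

lemma continuous_energyTensor_zero_succ (hq : IsQuietOutside ρ N S r n s u) (i : Fin 3) :
    Continuous fun x => energyTensor ρ (n x) (s x) (u x) 0 i.succ := by
  have hu := hq.continuous_u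
  simp only [energyTensor_zero_succ, fourVel_zero]
  exact ((hq.continuous_rho.add hq.continuous_pressure).mul (by fun_prop)).mul (by fun_prop)

lemma integrable_energy (hq : IsQuietOutside ρ N S r n s u) :
    Integrable fun x => energyTensor ρ (n x) (s x) (u x) 0 0 - energyTensor ρ N S 0 0 0 :=
  integrable_of_forall_lt_norm (r := r) (hq.continuous_energyTensor_zero_zero.sub continuous_const)
    fun x hx => by simp [hq.quiet x hx]

lemma integrable_radialMomentum (hq : IsQuietOutside ρ N S r n s u) :
    Integrable fun x => ∑ i : Fin 3, x i * energyTensor ρ (n x) (s x) (u x) 0 i.succ :=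
  integrable_of_forall_lt_norm (r := r) (continuous_finsetSum _ fun i _ =>
      (by fun_prop : Continuous fun x : Space => x i).mul (hq.continuous_energyTensor_zero_succ i))
    fun x hx => by simp [hq.quiet x hx, energyTensor_zero_succ]

lemma integrable_kinetic (hq : IsQuietOutside ρ N S r n s u) :
    Integrable fun x => (ρ (n x) (s x) + pressure ρ (n x) (s x)) * ‖u x‖ ^ 2 :=
  integrable_of_forall_lt_norm (r := r) ((hq.continuous_rho.add hq.continuous_pressure).mul
      (hq.continuous_u.norm.pow 2))
    fun x hx => by simp [hq.quiet x hx]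

lemma integrable_pressure (hq : IsQuietOutside ρ N S r n s u) :
    Integrable fun x => pressure ρ (n x) (s x) - pressure ρ N S :=
  integrable_of_forall_lt_norm (r := r) (hq.continuous_pressure.sub continuous_const)
    fun x hx => by simp [hq.quiet x hx]

lemma sq_radialMomentum_le (hq : IsQuietOutside ρ N S r n s u) (hρ : IsEquationOfState ρ)
    (hr : 0 ≤ r) :
    radialMomentum ρ n s u ^ 2 ≤
      2 * (perturbationEnergy ρ N S n s u * r ^ 2 + 4 * Real.pi / 3 * ρ N S * r ^ 5) *
        kineticIntegral ρ n s u := by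
  let B : Space → ℝ := (Metric.closedBall 0 r).indicator fun _ => ρ N S
  let T : Space → ℝ := fun x => energyTensor ρ (n x) (s x) (u x) 0 0 - energyTensor ρ N S 0 0 0
  have hB : Integrable B := integrable_indicator_closedBall 0 r (ρ N S)
  have hinside : ∀ x, ‖x‖ ≤ r → T x + B x = energyTensor ρ (n x) (s x) (u x) 0 0 := fun x hx => by
    have hBx : B x = ρ N S := indicator_of_mem (mem_closedBall_zero_iff.2 hx) _
    simp [T, hBx, energyTensor_zero_zero ρ N S]
  have houtside : ∀ x, r < ‖x‖ → T x + B x = 0 := fun x hx => by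
    have hBx : B x = 0 := indicator_of_notMem (by simpa using hx) _
    simp [T, hBx, hq.quiet x hx]
  have hmass : ∫ x, 2 * r ^ 2 * (T x + B x) =
      2 * (perturbationEnergy ρ N S n s u * r ^ 2 + 4 * Real.pi / 3 * ρ N S * r ^ 5) := by
    have hBr : ∫ x, B x = 4 * Real.pi / 3 * ρ N S * r ^ 3 :=
      integral_indicator_closedBall 0 hr (ρ N S)
    rw [integral_const_mul, integral_add hq.integrable_energy hB, hBr, perturbationEnergy]
    ring
  rw [← hmass]
  refine sq_integral_le_mul_integral hq.integrable_radialMomentum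
    ((hq.integrable_energy.add hB).const_mul _) hq.integrable_kinetic (fun x => ?_)
    (fun x => mul_nonneg (hρ.rho_add_pressure_nonneg (hq.n_nonneg x) (hq.s_nonneg x))
      (sq_nonneg _)) fun x => ?_
  · refine mul_nonneg (by positivity) ?_
    rcases le_or_gt ‖x‖ r with hx | hx
    · exact (hρ.energyTensor_zero_zero_nonneg (hq.n_nonneg x) (hq.s_nonneg x) _).trans_eq
        (hinside x hx).symm
    · exact (houtside x hx).ge
  · rcases le_or_gt ‖x‖ r with hx | hx
    · have hT := hρ.energyTensor_zero_zero_nonneg (hq.n_nonneg x) (hq.s_nonneg x) (u x)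
      have hH := hρ.rho_add_pressure_nonneg (hq.n_nonneg x) (hq.s_nonneg x)
      refine (hρ.sq_sum_mul_energyTensor_le (hq.n_nonneg x) (hq.s_nonneg x) (u x) x).trans ?_
      rw [hinside x hx]
      gcongr
    · simp [hq.quiet x hx, energyTensor_zero_succ]

lemma mul_kineticIntegral_le_virial (hq : IsQuietOutside ρ N S r n s u)
    (hρ : IsEquationOfState ρ) (hA1 : RhoAntitoneInEntropy ρ)
    (hA2 : SoundSpeedMonotoneInPressure ρ) (hN : 0 < N) (hS : 0 ≤ S) (hs : ∀ x, S ≤ s x)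
    (hE : 0 ≤ perturbationEnergy ρ N S n s u) :
    (1 - 3 * soundSpeed ρ N S ^ 2) * kineticIntegral ρ n s u ≤ virial ρ N S n s u := by
  have hK := hq.integrable_kinetic.const_mul (1 - 3 * soundSpeed ρ N S ^ 2)
  have hT := hq.integrable_energy.const_mul (3 * soundSpeed ρ N S ^ 2)
  calc (1 - 3 * soundSpeed ρ N S ^ 2) * kineticIntegral ρ n s u
      ≤ (1 - 3 * soundSpeed ρ N S ^ 2) * kineticIntegral ρ n s u +
          3 * soundSpeed ρ N S ^ 2 * perturbationEnergy ρ N S n s u :=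
        le_add_of_nonneg_right (by positivity)
    _ = ∫ x, ((1 - 3 * soundSpeed ρ N S ^ 2) *
            ((ρ (n x) (s x) + pressure ρ (n x) (s x)) * ‖u x‖ ^ 2) +
          3 * soundSpeed ρ N S ^ 2 *
            (energyTensor ρ (n x) (s x) (u x) 0 0 - energyTensor ρ N S 0 0 0)) := by
        rw [integral_add hK hT, integral_const_mul, integral_const_mul]
        rfl
    _ ≤ virial ρ N S n s u := by
        refine integral_mono (hK.add hT)
          (hq.integrable_kinetic.add (hq.integrable_pressure.const_mul 3)) fun x => ?_
        have hp := hρ.soundSpeed_sq_mul_rho_sub_le hA1 hA2 hN hS (hq.n_nonneg x) (hs x)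
        simp only [energyTensor_zero_zero, norm_zero]
        linarith

lemma riccati_le_virial (hq : IsQuietOutside ρ N S r n s u) (hρ : IsEquationOfState ρ)
    (hA1 : RhoAntitoneInEntropy ρ) (hA2 : SoundSpeedMonotoneInPressure ρ) (hN : 0 < N)
    (hS : 0 ≤ S) (hη : 3 * soundSpeed ρ N S ^ 2 ≤ 1) (hs : ∀ x, S ≤ s x)
    (hE : 0 < perturbationEnergy ρ N S n s u) (hr : 0 < r) :
    (1 - 3 * soundSpeed ρ N S ^ 2) / 2 *
        (1 / (perturbationEnergy ρ N S n s u * r ^ 2 + 4 * Real.pi / 3 * ρ N S * r ^ 5)) *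
        radialMomentum ρ n s u ^ 2 ≤ virial ρ N S n s u := by
  have hρN : 0 ≤ ρ N S := hρ.rho_nonneg N S hN.le hS
  set D := perturbationEnergy ρ N S n s u * r ^ 2 + 4 * Real.pi / 3 * ρ N S * r ^ 5
  have hD0 : 0 < D := by positivity
  have hQ : radialMomentum ρ n s u ^ 2 / (2 * D) ≤ kineticIntegral ρ n s u :=
    (div_le_iff₀' (by positivity)).2 (hq.sq_radialMomentum_le hρ hr.le)
  calc (1 - 3 * soundSpeed ρ N S ^ 2) / 2 * (1 / D) * radialMomentum ρ n s u ^ 2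
      = (1 - 3 * soundSpeed ρ N S ^ 2) * (radialMomentum ρ n s u ^ 2 / (2 * D)) := by
        field_simp
    _ ≤ (1 - 3 * soundSpeed ρ N S ^ 2) * kineticIntegral ρ n s u :=
        mul_le_mul_of_nonneg_left hQ (sub_nonneg.2 hη)
    _ ≤ virial ρ N S n s u := hq.mul_kineticIntegral_le_virial hρ hA1 hA2 hN hS hs hE.le

end IsQuietOutside

lemma IsGlobalC1Solution.isQuietOutside {n₀ s₀ : Space → ℝ} {u₀ : Space → Space}
    {n s : Spacetime → ℝ} {u : Spacetime → Space} {R t : ℝ}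
    (sol : IsGlobalC1Solution ρ n₀ s₀ u₀ n s u) (hρ : IsEquationOfState ρ) (hN : 0 < N)
    (hS : 0 ≤ S) (hquiet : ∀ x, R < ‖x‖ → n₀ x = N ∧ s₀ x = S ∧ u₀ x = 0) (ht : 0 ≤ t) :
    IsQuietOutside ρ N S (R + soundSpeed ρ N S * t) (n.curry t) (s.curry t) (u.curry t) where
  n_nonneg _ := sol.n_nonneg _ ht
  s_nonneg _ := sol.s_nonneg _ ht
  continuous_rho := continuous_slice sol.contDiff_rho.continuousOn ht
  continuous_pressure := continuous_slice sol.contDiff_pressure.continuousOn ht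
  continuous_u := continuous_slice sol.contDiff_u.continuousOn ht
  quiet x hx := by
    simpa [fluidState] using sol.fluidState_eq_of_add_lt_norm hρ hN hS hquiet ht hx

end VirialInequality

section FormationOfSingularities

variable {ρ : ℝ → ℝ → ℝ} {N S R : ℝ} {n₀ s₀ : Space → ℝ} {u₀ : Space → Space}
  {n s : Spacetime → ℝ} {u : Spacetime → Space}

lemma IsGlobalC1Solution.radialMomentum_zero (sol : IsGlobalC1Solution ρ n₀ s₀ u₀ n s u) :
    radialMomentum ρ (n.curry 0) (s.curry 0) (u.curry 0) = radialMomentum ρ n₀ s₀ u₀ := by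
  simp only [radialMomentum, Function.curry_apply, sol.init_n, sol.init_s, sol.init_u]

lemma IsGlobalC1Solution.integral_one_div_le (sol : IsGlobalC1Solution ρ n₀ s₀ u₀ n s u)
    (hρ : IsEquationOfState ρ) (hA1 : RhoAntitoneInEntropy ρ)
    (hA2 : SoundSpeedMonotoneInPressure ρ) (hR : 0 < R) (hN : 0 < N) (hS : 0 ≤ S)
    (hquiet : ∀ x, R < ‖x‖ → n₀ x = N ∧ s₀ x = S ∧ u₀ x = 0)
    (hη : 3 * soundSpeed ρ N S ^ 2 ≤ 1) (hs₀ : ∀ x, S ≤ s₀ x)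
    (hE : 0 < perturbationEnergy ρ N S n₀ s₀ u₀) (hQ : 0 < radialMomentum ρ n₀ s₀ u₀) :
    (1 - 3 * soundSpeed ρ N S ^ 2) / 2 *
        ∫ r in Ioi R, 1 / (perturbationEnergy ρ N S n₀ s₀ u₀ * r ^ 2 +
          4 * Real.pi / 3 * ρ N S * r ^ 5) ≤
      soundSpeed ρ N S * (radialMomentum ρ n₀ s₀ u₀)⁻¹ := by
  have hη0 := hρ.soundSpeed_pos hN hS
  have ha : 0 ≤ 4 * Real.pi / 3 * ρ N S :=
    mul_nonneg (by positivity) (hρ.rho_nonneg N S hN.le hS)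
  have hk : 0 ≤ (1 - 3 * soundSpeed ρ N S ^ 2) / 2 := by linarith
  have hden : ∀ r, R ≤ r → 0 < perturbationEnergy ρ N S n₀ s₀ u₀ * r ^ 2 +
      4 * Real.pi / 3 * ρ N S * r ^ 5 := fun r hr => by
    have hr0 := hR.trans_le hr
    positivity
  rw [← integral_const_mul, ← sol.radialMomentum_zero]
  refine integral_Ioi_le_of_riccati
    (Q := fun t => radialMomentum ρ (n.curry t) (s.curry t) (u.curry t)) hη0
    (sol.continuousOn_radialMomentum hρ hN hS hquiet)
    (fun t ht => sol.hasDerivAt_radialMomentum hρ hN hS hquiet ht)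
    (continuousOn_const.mul (continuousOn_const.div (by fun_prop) fun r hr => (hden r hr).ne'))
    (fun r hr => mul_nonneg hk (one_div_pos.2 (hden r (le_of_lt hr))).le)
    ((integrableOn_Ioi_one_div hE ha hR).const_mul _) (fun t ht => ?_)
    (hQ.trans_eq sol.radialMomentum_zero.symm)
  have hconserved := sol.perturbationEnergy_eq hρ hN hS hquiet ht.le
  rw [← hconserved] at hE ⊢
  exact (sol.isQuietOutside hρ hN hS hquiet ht.le).riccati_le_virial hρ hA1 hA2 hN hS hη
    (fun _ => sol.le_entropy hs₀ ht.le) hE (by positivity)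

end FormationOfSingularities

end

end RelFluid

theorem mainTheorem1_general {ρ : ℝ → ℝ → ℝ} (hρ : RelFluid.IsEquationOfState ρ)
    (hA1 : RelFluid.RhoAntitoneInEntropy ρ) (hA2 : RelFluid.SoundSpeedMonotoneInPressure ρ)
    {R₀ nbar sbar : ℝ} (hR₀ : 0 < R₀) (hnbar : 0 < nbar) (hsbar : 0 ≤ sbar)
    {n₀ s₀ : RelFluid.Space → ℝ} {u₀ : RelFluid.Space → RelFluid.Space}
    (hquiet : ∀ x, R₀ < ‖x‖ → n₀ x = nbar ∧ s₀ x = sbar ∧ u₀ x = 0)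
    (hD1 : 3 * RelFluid.soundSpeed ρ nbar sbar ^ 2 < 1)
    (hD2 : 0 < RelFluid.perturbationEnergy ρ nbar sbar n₀ s₀ u₀)
    (hD3 : ∀ x, ‖x‖ ≤ R₀ → sbar ≤ s₀ x)
    (hD4 : 2 * RelFluid.soundSpeed ρ nbar sbar / (1 - 3 * RelFluid.soundSpeed ρ nbar sbar ^ 2) *
        (∫ r in Set.Ioi R₀, 1 / (RelFluid.perturbationEnergy ρ nbar sbar n₀ s₀ u₀ * r ^ 2 +
          4 * Real.pi / 3 * ρ nbar sbar * r ^ 5))⁻¹ <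
      RelFluid.radialMomentum ρ n₀ s₀ u₀) :
    ¬ ∃ (n s : RelFluid.Spacetime → ℝ) (u : RelFluid.Spacetime → RelFluid.Space),
      RelFluid.IsGlobalC1Solution ρ n₀ s₀ u₀ n s u := by
  rintro ⟨n, s, u, sol⟩
  have hη := hρ.soundSpeed_pos hnbar hsbar
  have hk := sub_pos.2 hD1
  have hI := RelFluid.integral_Ioi_one_div_pos hD2
    (mul_nonneg (by positivity) (hρ.rho_nonneg nbar sbar hnbar.le hsbar) :
      0 ≤ 4 * Real.pi / 3 * ρ nbar sbar) hR₀
  have hQ : 0 < RelFluid.radialMomentum ρ n₀ s₀ u₀ := lt_of_le_of_lt (by positivity) hD4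
  have hs₀ : ∀ x, sbar ≤ s₀ x := fun x =>
    (le_or_gt ‖x‖ R₀).elim (hD3 x) fun hx => (hquiet x hx).2.1.ge
  have hle := sol.integral_one_div_le hρ hA1 hA2 hR₀ hnbar hsbar hquiet hD1.le hs₀ hD2 hQ
  rw [← div_eq_mul_inv, le_div_iff₀ hQ] at hle
  rw [← div_eq_mul_inv, div_div, div_lt_iff₀ (by positivity)] at hD4
  linarith

theorem mainTheorem1 (ρ : ℝ → ℝ → ℝ) (hρ : RelFluid.IsEquationOfState ρ)
    (hA1 : RelFluid.RhoAntitoneInEntropy ρ)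
    (hA2 : RelFluid.SoundSpeedMonotoneInPressure ρ)
    (R₀ nbar sbar : ℝ) (n₀ s₀ : RelFluid.Space → ℝ) (u₀ : RelFluid.Space → RelFluid.Space)
    (hdata : RelFluid.IsQuietPerturbation R₀ nbar sbar n₀ s₀ u₀)
    (E : ℝ) (hE : E = RelFluid.perturbationEnergy ρ nbar sbar n₀ s₀ u₀)
    (etabar : ℝ) (hetabar : etabar = RelFluid.soundSpeed ρ nbar sbar)
    (hD1 : etabar < 1 / 3)
    (hD2 : 0 < E)
    (hD3 : ∀ x : RelFluid.Space, ‖x‖ ≤ R₀ → sbar ≤ s₀ x)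
    (hD4 : 2 * etabar / (1 - 3 * etabar ^ 2) *
        (∫ r in Set.Ioi R₀, 1 / (E * r ^ 2 + 4 * Real.pi / 3 * ρ nbar sbar * r ^ 5))⁻¹ <
      RelFluid.radialMomentum ρ n₀ s₀ u₀) :
    ¬ ∃ (n s : RelFluid.Spacetime → ℝ) (u : RelFluid.Spacetime → RelFluid.Space),
      RelFluid.IsGlobalC1Solution ρ n₀ s₀ u₀ n s u := by
  subst hE hetabar
  have hη := hρ.soundSpeed_pos hdata.nbar_pos hdata.sbar_pos.le
  exact mainTheorem1_general hρ hA1 hA2 hdata.R₀_pos hdata.nbar_pos hdata.sbar_pos.le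
    (fun x hx => ⟨hdata.n₀_eq x hx, hdata.s₀_eq x hx, hdata.u₀_eq x hx⟩)
    (by nlinarith) hD2 hD3 hD4
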